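/- Let $n,m\ge 1$ be integers and $1\le r<\infty$; put $r'=r/(r-1)$ ($r'=\infty$ if $r=1$). Cubes in $\mathbb{R}^n$ have sides parallel to the axes, $aQ$ denotes the cube concentric with $Q$ with $a$ times its side length, and $Q^m=Q\times\cdots\times Q\subset(\mathbb{R}^n)^m$. Let $T$ be an $m$-linear operator, defined on $L^r(\mathbb{R}^n)\times\cdots\times L^r(\mathbb{R}^n)$ and bounded from this space to $L^{r/m,\infty}(\mathbb{R}^n)$, with operator quasi-norm $$\|T\|:=\|T\|_{L^r\times\cdots\times L^r\to L^{r/m,\infty}}<\infty .$$ Suppose that $T$ is a singular integral operator with kernel $K(x,y_1,\dots,y_m)$, that is, for all bounded measurable compactly supported $f_1,\dots,f_m$ and almost every $x\notin\bigcap_{i=1}^m\operatorname{supp} f_i$, $$T(f_1,\dots,f_m)(x)=\int_{(\mathbb{R}^n)^m}K(x,y_1,\dots,y_m)\prod_{i=1}^m f_i(y_i)\,d\vec y ,$$ with absolute convergence, and that $K$ satisfies the $m$-linear $L^r$-Hörmander condition $$K_r:=\sup_Q\ \sup_{x,z\in\frac12 Q}\ \sum_{k=1}^\infty |2^kQ|^{m/r}\,\big\|K(x,\cdot)-K(z,\cdot)\big\|_{L^{r'}((2^kQ)^m\setminus(2^{k-1}Q)^m)}<\infty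 ,$$ the supremum being over all cubes $Q$. Then for all compactly supported $f_1,\dots,f_m\in L^r(\mathbb{R}^n)$ there is a $\gamma$-sparse family $\mathcal S$ of cubes such that for almost every $x\in\mathbb{R}^n$, $$|T(f_1,\dots,f_m)(x)|\le c\,(\|T\|+K_r)\sum_{Q\in\mathcal S}\ \prod_{i=1}^m\Big(\frac1{|Q|}\int_Q|f_i|^r\Big)^{1/r}\chi_Q(x).$$ Here $\gamma\in(0,1)$ depends only on $n$, and $c$ only on $n,m,r$; a family $\mathcal S$ of cubes is $\gamma$-sparse if there are pairwise disjoint measurable sets $E_Q\subset Q$ ($Q\in\mathcal S$) with $|E_Q|\ge\gamma|Q|$. -/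

import Mathlib

open MeasureTheory
open scoped ENNReal NNReal

noncomputable section

namespace SparseDomination

/-- A cube in `ℝⁿ` with sides parallel to the axes, given by its centre and its side length. -/
@[ext]
structure Cube (n : ℕ) where
  center : Fin n → ℝ
  side : ℝ
  side_pos : 0 < side

namespace Cube

variable {n : ℕ}

/-- The (half-open) set of points of the cube. -/
def toSet (Q : Cube n) : Set (Fin n → ℝ) :=
  Set.univ.pi fun j => Set.Ico (Q.center j - Q.side / 2) (Q.center j + Q.side / 2)

/-- The concentric dilate `aQ`, with side length `a * ℓ(Q)`. -/
def dilate (Q : Cube n) (a : ℝ) (ha : 0 < a) : Cube n where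
  center := Q.center
  side := a * Q.side
  side_pos := mul_pos ha Q.side_pos

/-- The concentric dilate `2^k Q`. -/
def twoPow (Q : Cube n) (k : ℕ) : Cube n := Q.dilate (2 ^ k) (by positivity)

/-- The concentric cube `½ Q`. -/
def half (Q : Cube n) : Cube n := Q.dilate (1 / 2) (by norm_num)

/-- The `m`-fold product `Q × ⋯ × Q`, a subset of `(ℝⁿ)ᵐ`. -/
def power (Q : Cube n) (m : ℕ) : Set (Fin m → Fin n → ℝ) :=
  Set.univ.pi fun _ => Q.toSet

end Cube

/-- `S` is a `γ`-sparse family of cubes: there are pairwise disjoint measurable sets `E Q ⊆ Q`,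
`Q ∈ S`, with `|E Q| ≥ γ |Q|`. -/
def IsSparse {n : ℕ} (γ : ℝ) (S : Set (Cube n)) : Prop :=
  ∃ E : Cube n → Set (Fin n → ℝ),
    (∀ Q ∈ S, MeasurableSet (E Q) ∧ E Q ⊆ Q.toSet ∧
      ENNReal.ofReal γ * volume Q.toSet ≤ volume (E Q)) ∧
    S.PairwiseDisjoint E

/-- The weak `L^p` quasi-norm `sup_{t > 0} t |{x : |g x| > t}|^{1/p}` (for `0 < p < ∞`). -/
def weakNorm {n : ℕ} {𝕜 : Type*} [RCLike 𝕜] (p : ℝ) (g : (Fin n → ℝ) → 𝕜) : ℝ≥0∞ :=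
  ⨆ t : ℝ≥0, (t : ℝ≥0∞) * volume {x | (t : ℝ≥0∞) < ‖g x‖ₑ} ^ (1 / p)

/-- The `m`-linear operators `T` defined on `L^r(ℝⁿ) × ⋯ × L^r(ℝⁿ)`, with values in the (classes
of) measurable functions on `ℝⁿ`. -/
abbrev MultilinearOperator (𝕜 : Type*) [RCLike 𝕜] (n m : ℕ) (r : ℝ) :=
  MultilinearMap 𝕜 (fun _ : Fin m => Lp (α := Fin n → ℝ) 𝕜 (ENNReal.ofReal r) volume)
    ((Fin n → ℝ) →ₘ[volume] 𝕜)

/-- The operator quasi-norm of `T` from `L^r × ⋯ × L^r` to `L^{r/m,∞}`: the least `C ∈ [0,∞]` with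
`‖T(f₁,…,f_m)‖_{L^{r/m,∞}} ≤ C ∏ ‖f_i‖_{L^r}`. It is finite exactly if `T` is bounded. -/
def opNorm {𝕜 : Type*} [RCLike 𝕜] {n m : ℕ} {r : ℝ} (T : MultilinearOperator 𝕜 n m r) : ℝ≥0∞ :=
  sInf {C : ℝ≥0∞ | ∀ f : Fin m → Lp (α := Fin n → ℝ) 𝕜 (ENNReal.ofReal r) volume,
    weakNorm (r / m) (T f) ≤ C * ∏ i, eLpNorm (f i) (ENNReal.ofReal r) volume}

/-- `T` is the singular integral operator with kernel `K(x, y₁, …, y_m)`: for all bounded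
functions `f₁, …, f_m` with compact support and almost every `x ∉ ⋂ supp f_i`,
`T(f₁,…,f_m)(x) = ∫ K(x, y₁, …, y_m) f₁(y₁) ⋯ f_m(y_m) dy`, where the integral converges absolutely.
The values of `K` on the diagonal `x = y₁ = ⋯ = y_m` play no role. -/
def HasKernel {𝕜 : Type*} [RCLike 𝕜] {n m : ℕ} {r : ℝ} (T : MultilinearOperator 𝕜 n m r)
    (K : (Fin n → ℝ) → (Fin m → Fin n → ℝ) → 𝕜) : Prop :=
  ∀ (f : Fin m → (Fin n → ℝ) → 𝕜) (hf : ∀ i, MemLp (f i) (ENNReal.ofReal r) volume),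
    (∀ i, HasCompactSupport (f i)) → (∀ i, ∃ B : ℝ, ∀ y, ‖f i y‖ ≤ B) →
    ∀ᵐ x : Fin n → ℝ, x ∉ ⋂ i, tsupport (f i) →
      Integrable (fun y : Fin m → Fin n → ℝ => K x y * ∏ i, f i (y i)) ∧
      T (fun i => (hf i).toLp (f i)) x = ∫ y : Fin m → Fin n → ℝ, K x y * ∏ i, f i (y i)

/-- The constant `K_r` of the `m`-linear `L^r`-Hörmander condition,
`sup_Q sup_{x, z ∈ ½Q} ∑_{k ≥ 1} |2^k Q|^{m/r} ‖K(x, ·) - K(z, ·)‖_{L^{r'}((2^k Q)^m ∖ (2^{k-1} Q)^m)}`,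
where `r' = r / (r - 1)`, and `r' = ∞` (the essential supremum) if `r = 1`. The condition is that
this constant is finite. -/
def hormanderConst {𝕜 : Type*} [RCLike 𝕜] {n m : ℕ} (r : ℝ)
    (K : (Fin n → ℝ) → (Fin m → Fin n → ℝ) → 𝕜) : ℝ≥0∞ :=
  ⨆ (Q : Cube n) (x ∈ Q.half.toSet) (z ∈ Q.half.toSet),
    ∑' k : ℕ, volume (Q.twoPow (k + 1)).toSet ^ ((m : ℝ) / r) *
      eLpNorm (fun y => K x y - K z y) (ENNReal.conjExponent (ENNReal.ofReal r))
        (volume.restrict ((Q.twoPow (k + 1)).power m \ (Q.twoPow k).power m))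

/-- The sparse form `∑_{Q ∈ S} ∏_i ⟨|f_i|^r⟩_Q^{1/r} χ_Q(x)`, a sum in `[0,∞]`, where `⟨g⟩_Q` is the
average of `g` over `Q`. -/
def sparseSum {𝕜 : Type*} [RCLike 𝕜] {n m : ℕ} (r : ℝ) (S : Set (Cube n))
    (f : Fin m → (Fin n → ℝ) → 𝕜) (x : Fin n → ℝ) : ℝ≥0∞ :=
  ∑' Q : S, (Q : Cube n).toSet.indicator
    (fun _ => ∏ i, ((volume (Q : Cube n).toSet)⁻¹ *
      ∫⁻ y in (Q : Cube n).toSet, ‖f i y‖ₑ ^ r) ^ (1 / r)) x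

end SparseDomination

end

noncomputable section

namespace SparseDomination

open Set Filter Topology

/-! ### Geometry of cubes and a Vitali bound -/

namespace Cube

variable {n : ℕ}

/-! The argument is a stopping time construction on dyadic cubes. Fix a dyadic cube `Q`, let `P` be
the product of the `L^r` averages over `5Q`, and look at `T(f χ_{5Q})` on `Q`. Let `E` be the set
where it exceeds a large multiple of `‖T‖ P`. The children of `Q` are the maximal dyadic subcubes in
which `E` has noticeable density, or over whose fivefold dilate some `|f_i|^r` has a large average.
The weak type bound for `T` and the Vitali covering lemma show that the children fill at most half
of `Q` (`two_mul_volume_union_maximal_le`).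

Off the children almost every point lies outside `E`, by Lebesgue density, so `T(f χ_{5Q})` is
bounded there by the desired term. On a child `R`, the proper ancestors inside `Q` did not stop, so
the averages of `|f_i|^r` over the dilates `2^k R` are under control, and the Hörmander condition
bounds the oscillation on `R` of `T(f χ_{5Q}) - T(f χ_{5R})`. At some point `z` of `R` both terms
are small: the first because `E` fills at most half of `R`, the second by the weak type bound. Hence
`|T(f χ_{5Q})| ≤ A + |T(f χ_{5R})|` almost everywhere on `R`, with `A` a multiple of `(‖T‖ + K_r) P`
(`exists_children`). Comparing with a point `z` in this way makes a maximal truncation of `T`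
unnecessary.

Iterating the estimate (`exists_sparse_of_children`) gives a sparse sum over the descendants. The
iteration starts from a partition of space into dyadic cubes whose fivefold dilates contain every
support (`exists_partition`), so that `T(f χ_{5Q}) = T(f)` at the first step. Since the averages are
over `5Q`, the final family consists of the dilates. -/

lemma mem_toSet {Q : Cube n} {x : Fin n → ℝ} :
    x ∈ Q.toSet ↔ ∀ j, Q.center j - Q.side / 2 ≤ x j ∧ x j < Q.center j + Q.side / 2 := by
  simp [toSet, Set.mem_pi]

lemma measurableSet_toSet (Q : Cube n) : MeasurableSet Q.toSet :=
  MeasurableSet.univ_pi fun _ => measurableSet_Ico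

lemma volume_toSet (Q : Cube n) : volume Q.toSet = ENNReal.ofReal Q.side ^ n := by
  rw [toSet, Real.volume_pi_Ico]
  simp

lemma volume_toSet_ne_zero (Q : Cube n) : volume Q.toSet ≠ 0 := by
  rw [volume_toSet]
  exact pow_ne_zero _ (by simpa using Q.side_pos)

lemma volume_toSet_ne_top (Q : Cube n) : volume Q.toSet ≠ ∞ := by
  rw [volume_toSet]
  exact ENNReal.pow_ne_top ENNReal.ofReal_ne_top

lemma volume_dilate (Q : Cube n) {a : ℝ} (ha : 0 < a) :
    volume (Q.dilate a ha).toSet = ENNReal.ofReal a ^ n * volume Q.toSet := by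
  rw [volume_toSet, volume_toSet, ← mul_pow, ← ENNReal.ofReal_mul ha.le]
  rfl

/-- The concentric cube `5Q`. -/
def five (Q : Cube n) : Cube n := Q.dilate 5 (by norm_num)

lemma volume_five (Q : Cube n) : volume Q.five.toSet = 5 ^ n * volume Q.toSet := by
  rw [five, volume_dilate]
  simp

lemma five_injective : Function.Injective (five : Cube n → Cube n) := by
  intro P Q h
  have h1 := congrArg Cube.center h
  have h2 := congrArg Cube.side h
  simp only [five, dilate] at h1 h2
  ext1
  · exact h1
  · linarith

lemma toSet_subset_dilate (Q : Cube n) {a : ℝ} (ha : 1 ≤ a) :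
    Q.toSet ⊆ (Q.dilate a (by linarith)).toSet := by
  intro x hx
  rw [mem_toSet] at hx ⊢
  intro j
  have := hx j
  have hs := Q.side_pos
  simp only [dilate]
  constructor <;> nlinarith

lemma toSet_subset_five (Q : Cube n) : Q.toSet ⊆ Q.five.toSet :=
  Q.toSet_subset_dilate (by norm_num)

lemma closedBall_eq_Icc (Q : Cube n) :
    Metric.closedBall Q.center (Q.side / 2) =
      Set.Icc (fun j => Q.center j - Q.side / 2) (fun j => Q.center j + Q.side / 2) := by
  rw [closedBall_pi _ (by linarith [Q.side_pos])]
  simp only [Real.closedBall_eq_Icc, Set.pi_univ_Icc]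

lemma toSet_subset_closedBall (Q : Cube n) :
    Q.toSet ⊆ Metric.closedBall Q.center (Q.side / 2) := by
  intro x hx
  rw [closedBall_eq_Icc]
  rw [mem_toSet] at hx
  exact ⟨fun j => (hx j).1, fun j => (hx j).2.le⟩

lemma toSet_ae_eq_closedBall (Q : Cube n) :
    Q.toSet =ᵐ[volume] Metric.closedBall Q.center (Q.side / 2) := by
  rw [closedBall_eq_Icc]
  exact Measure.univ_pi_Ico_ae_eq_Icc

/-- A weak type bound for averages over dilated cubes, by the Vitali covering lemma. -/
theorem mul_volume_biUnion_le {ι : Type*} {t : Set ι} (ht : t.Countable) (R : ι → Cube n) (B : ℝ)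
    (hB : ∀ i ∈ t, (R i).side ≤ B) (g : (Fin n → ℝ) → ℝ≥0∞) (c : ℝ≥0∞)
    (h : ∀ i ∈ t, c * volume (R i).toSet ≤ ∫⁻ y in (R i).five.toSet, g y) :
    c * volume (⋃ i ∈ t, (R i).toSet) ≤ 25 ^ n * ∫⁻ y, g y := by
  -- In the sup norm these balls are the closed cubes `5R`. Selecting disjoint dilates lets the
  -- integrals over them add up; the dilation and the Vitali enlargement cost a factor 5 each,
  -- whence `25 ^ n`.
  obtain ⟨u, hut, hdisj, hcov⟩ := Vitali.exists_disjoint_subfamily_covering_enlargement_closedBall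
    t (fun i => (R i).center) (fun i => 5 * (R i).side / 2) (5 * B / 2)
    (fun i hi => by have := hB i hi; linarith) 5 (by norm_num)
  have hu : u.Countable := ht.mono hut
  have : Countable u := hu.to_subtype
  have hsub : (⋃ i ∈ t, (R i).toSet) ⊆
      ⋃ b ∈ u, Metric.closedBall (R b).center (5 * (5 * (R b).side / 2)) := by
    refine iUnion₂_subset fun i hi => ?_
    obtain ⟨b, hb, hib⟩ := hcov i hi
    refine ((R i).toSet_subset_five.trans ?_).trans (hib.trans (subset_biUnion_of_mem
      (u := fun b => Metric.closedBall (R b).center (5 * (5 * (R b).side / 2))) hb))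
    exact (R i).five.toSet_subset_closedBall
  have hvol : ∀ b, volume (Metric.closedBall (R b).center (5 * (5 * (R b).side / 2))) =
      25 ^ n * volume (R b).toSet := by
    intro b
    have hs := (R b).side_pos
    have h25 : (25 : ℝ≥0∞) = ENNReal.ofReal 25 := by simp
    rw [Real.volume_pi_closedBall _ (by linarith), volume_toSet, Fintype.card_fin, h25, ← mul_pow,
      ← ENNReal.ofReal_mul (by norm_num), ← ENNReal.ofReal_pow (by positivity)]
    congr 2
    ring
  calc c * volume (⋃ i ∈ t, (R i).toSet)
      ≤ c * ∑' b : u, volume (Metric.closedBall (R b).center (5 * (5 * (R b).side / 2))) := by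
        gcongr
        exact (measure_mono hsub).trans (measure_biUnion_le _ hu _)
    _ = 25 ^ n * ∑' b : u, c * volume (R b).toSet := by
        simp only [hvol, ENNReal.tsum_mul_left]
        ring
    _ ≤ 25 ^ n * ∑' b : u, ∫⁻ y in (R b).five.toSet, g y := by
        gcongr with b
        exact h b (hut b.2)
    _ = 25 ^ n * ∫⁻ y in ⋃ b : u, (R b).five.toSet, g y := by
        rw [lintegral_iUnion (fun b => measurableSet_toSet _)]
        intro b b' hbb'
        refine (hdisj b.2 b'.2 fun h => hbb' (Subtype.ext h)).mono ?_ ?_ <;>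
        exact toSet_subset_closedBall _
    _ ≤ 25 ^ n * ∫⁻ y, g y := by
        gcongr
        exact Measure.restrict_le_self

end Cube

/-- Indices `(k, j)` of the dyadic cubes `2^k (j + [0,1)ⁿ)`. -/
abbrev Dyadic (n : ℕ) := ℤ × (Fin n → ℤ)

/-! ### Dyadic cubes and Lebesgue density -/

namespace Dyadic

variable {n : ℕ}

/-- The dyadic cube `2^k (j + [0,1)ⁿ)`. -/
def cube (d : Dyadic n) : Cube n where
  center l := (d.2 l + 1 / 2) * 2 ^ d.1
  side := 2 ^ d.1
  side_pos := by positivity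

/-- The dyadic cube of side length `2^k` that contains `x`. -/
def containing (k : ℤ) (x : Fin n → ℝ) : Dyadic n := (k, fun l => ⌊x l / 2 ^ k⌋)

lemma mem_cube_iff' {d : Dyadic n} {x : Fin n → ℝ} :
    x ∈ d.cube.toSet ↔ ∀ l, d.2 l * (2 : ℝ) ^ d.1 ≤ x l ∧ x l < (d.2 l + 1) * 2 ^ d.1 := by
  rw [Cube.mem_toSet]
  refine forall_congr' fun l => ?_
  simp only [cube]
  constructor <;> rintro ⟨h1, h2⟩ <;> constructor <;> linarith

lemma mem_cube_iff {d : Dyadic n} {x : Fin n → ℝ} :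
    x ∈ d.cube.toSet ↔ containing d.1 x = d := by
  rw [mem_cube_iff', Prod.ext_iff]
  simp only [containing, true_and, funext_iff]
  refine forall_congr' fun l => ?_
  have : (0 : ℝ) < 2 ^ d.1 := by positivity
  rw [Int.floor_eq_iff, le_div_iff₀ this, div_lt_iff₀ this]

lemma mem_containing (k : ℤ) (x : Fin n → ℝ) : x ∈ (containing k x).cube.toSet :=
  mem_cube_iff.2 rfl

lemma mem_containing_iff {k : ℤ} {x y : Fin n → ℝ} :
    y ∈ (containing k x).cube.toSet ↔ containing k y = containing k x :=
  mem_cube_iff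

lemma cube_nonempty (d : Dyadic n) : d.cube.toSet.Nonempty := by
  refine ⟨d.cube.center, Cube.mem_toSet.2 fun j => ?_⟩
  have := d.cube.side_pos
  constructor <;> linarith

lemma cube_injective : Function.Injective (cube : Dyadic n → Cube n) := by
  intro d e h
  have hs : (2 : ℝ) ^ d.1 = 2 ^ e.1 := congrArg Cube.side h
  have h1 : d.1 = e.1 := zpow_right_injective₀ (by norm_num) (by norm_num) hs
  obtain ⟨x, hx⟩ := d.cube_nonempty
  have hx' := hx
  rw [h] at hx'
  rw [← mem_cube_iff.1 hx, ← mem_cube_iff.1 hx', h1]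

/-- Nestedness of the dyadic grid: the index at a coarser scale is the integer quotient by `2 ^ i`
of the finer index. -/
lemma containing_add {k : ℤ} {x y : Fin n → ℝ} (h : containing k x = containing k y) (i : ℕ) :
    containing (k + i) x = containing (k + i) y := by
  have key : ∀ z : Fin n → ℝ, containing (k + i) z =
      (k + i, fun l => (containing k z).2 l / ((2 ^ i : ℕ) : ℤ)) := by
    intro z
    simp only [containing, Prod.mk.injEq, true_and]
    funext l
    rw [← Int.floor_div_natCast, zpow_add₀ (by norm_num), zpow_natCast, ← div_div]
    push_cast
    rfl
  rw [key, key, h]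

lemma containing_of_le {k k' : ℤ} (hk : k ≤ k') {x y : Fin n → ℝ}
    (h : containing k x = containing k y) : containing k' x = containing k' y := by
  obtain ⟨i, rfl⟩ := Int.le.dest hk
  exact containing_add h i

lemma containing_subset {k k' : ℤ} (hk : k ≤ k') (x : Fin n → ℝ) :
    (containing k x).cube.toSet ⊆ (containing k' x).cube.toSet := by
  intro y hy
  rw [mem_containing_iff] at hy ⊢
  exact containing_of_le hk hy

/-- Lebesgue's density theorem for dyadic cubes. -/
theorem ae_exists_lt_volume_inter {E : Set (Fin n → ℝ)} (hE : MeasurableSet E) (K : ℤ)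
    {θ : ℝ≥0∞} (hθ : θ < 1) : ∀ᵐ x : Fin n → ℝ, x ∈ E → ∃ i : ℕ,
      θ * volume (containing (K - i) x).cube.toSet <
        volume ((containing (K - i) x).cube.toSet ∩ E) := by
  -- This form of the density theorem allows balls that contain `x` without being centred at it;
  -- dyadic cubes are such balls up to null sets.
  have h := IsUnifLocDoublingMeasure.ae_tendsto_measure_inter_div
    (volume : Measure (Fin n → ℝ)) E 1
  rw [ae_restrict_iff' hE] at h
  filter_upwards [h] with x hx hxE
  have hlim : Tendsto (fun i : ℕ => (2 : ℝ) ^ (K - i) / 2) atTop (𝓝[>] 0) := by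
    rw [tendsto_nhdsWithin_iff]
    refine ⟨?_, Eventually.of_forall fun i => by simp only [mem_Ioi]; positivity⟩
    have := (tendsto_pow_atTop_nhds_zero_of_lt_one (r := (1 / 2 : ℝ)) (by norm_num)
      (by norm_num)).const_mul ((2 : ℝ) ^ K / 2)
    rw [mul_zero] at this
    refine this.congr fun i => ?_
    rw [zpow_sub₀ (by norm_num), zpow_natCast]
    field_simp
    rw [← mul_pow]
    norm_num
  have := hx hxE (fun i : ℕ => (containing (K - i) x).cube.center)
    (fun i : ℕ => (2 : ℝ) ^ (K - i) / 2) hlim (Eventually.of_forall fun i => by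
      rw [one_mul]
      exact Cube.toSet_subset_closedBall _ (mem_containing _ x))
  obtain ⟨i, hi⟩ := (this.eventually (lt_mem_nhds hθ)).exists
  refine ⟨i, ?_⟩
  have hae := (containing (K - i) x).cube.toSet_ae_eq_closedBall
  have h1 : volume (E ∩ Metric.closedBall (containing (K - i) x).cube.center ((2 : ℝ) ^ (K - i) / 2))
      = volume ((containing (K - i) x).cube.toSet ∩ E) := by
    rw [inter_comm]
    exact measure_congr (hae.symm.inter (ae_eq_refl E))
  have h2 : volume (Metric.closedBall (containing (K - i) x).cube.center ((2 : ℝ) ^ (K - i) / 2))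
      = volume (containing (K - i) x).cube.toSet := measure_congr hae.symm
  rw [h1, h2] at hi
  rwa [ENNReal.lt_div_iff_mul_lt (Or.inl (Cube.volume_toSet_ne_zero _))
    (Or.inl (Cube.volume_toSet_ne_top _))] at hi

end Dyadic

/-! ### Iteration over generations of children, and the initial partition -/

namespace Dyadic

variable {n : ℕ}

/-- The `k`-th generation of descendants of the family `F₀`, where `ch Q` are the children of
`Q`. -/
def generation (ch : Dyadic n → Set (Dyadic n)) (F₀ : Set (Dyadic n)) : ℕ → Set (Dyadic n)
  | 0 => F₀
  | k + 1 => ⋃ Q ∈ generation ch F₀ k, ch Q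

/-- The union of the cubes of a family. -/
def union (F : Set (Dyadic n)) : Set (Fin n → ℝ) := ⋃ Q ∈ F, Q.cube.toSet

lemma mem_union {F : Set (Dyadic n)} {x : Fin n → ℝ} :
    x ∈ union F ↔ ∃ Q ∈ F, x ∈ Q.cube.toSet := by simp [union]

lemma measurableSet_union (F : Set (Dyadic n)) : MeasurableSet (union F) :=
  MeasurableSet.biUnion F.to_countable fun Q _ => Q.cube.measurableSet_toSet

lemma volume_union {F : Set (Dyadic n)} (hF : F.PairwiseDisjoint fun Q => Q.cube.toSet) :
    volume (union F) = ∑' Q : F, volume (Q : Dyadic n).cube.toSet :=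
  measure_biUnion F.to_countable hF fun Q _ => Q.cube.measurableSet_toSet

variable {ch : Dyadic n → Set (Dyadic n)} {F₀ : Set (Dyadic n)}

lemma mem_generation_succ {k : ℕ} {R : Dyadic n} :
    R ∈ generation ch F₀ (k + 1) ↔ ∃ Q ∈ generation ch F₀ k, R ∈ ch Q := by
  simp [generation]

section

variable (hsub : ∀ Q, ∀ R ∈ ch Q, R.cube.toSet ⊆ Q.cube.toSet)
  (hdisj : ∀ Q, (ch Q).PairwiseDisjoint fun R => R.cube.toSet)
  (hF₀ : F₀.PairwiseDisjoint fun R => R.cube.toSet)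

include hsub hdisj hF₀ in
lemma pairwiseDisjoint_generation (k : ℕ) :
    (generation ch F₀ k).PairwiseDisjoint fun R => R.cube.toSet := by
  induction k with
  | zero => exact hF₀
  | succ k ih =>
    intro R hR R' hR' hne
    obtain ⟨Q, hQ, hRQ⟩ := mem_generation_succ.1 hR
    obtain ⟨Q', hQ', hRQ'⟩ := mem_generation_succ.1 hR'
    by_cases hQQ : Q = Q'
    · subst hQQ
      exact hdisj Q hRQ hRQ' hne
    · exact (ih hQ hQ' hQQ).mono (hsub _ _ hRQ) (hsub _ _ hRQ')

include hsub hdisj hF₀ in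
lemma generation_eq_of_mem {k : ℕ} {R R' : Dyadic n} {x : Fin n → ℝ}
    (hR : R ∈ generation ch F₀ k) (hR' : R' ∈ generation ch F₀ k)
    (hx : x ∈ R.cube.toSet) (hx' : x ∈ R'.cube.toSet) : R = R' := by
  by_contra hne
  exact Set.disjoint_left.1 (pairwiseDisjoint_generation hsub hdisj hF₀ k hR hR' hne) hx hx'

include hsub in
lemma union_generation_antitone : Antitone fun k => union (generation ch F₀ k) := by
  refine antitone_nat_of_succ_le fun k x hx => ?_
  obtain ⟨R, hR, hxR⟩ := mem_union.1 hx
  obtain ⟨Q, hQ, hRQ⟩ := mem_generation_succ.1 hR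
  exact mem_union.2 ⟨Q, hQ, hsub _ _ hRQ hxR⟩

include hsub hdisj hF₀ in
/-- The part of a cube of generation `k` that is not covered by its children is disjoint from the
next generation. -/
lemma notMem_union_generation_succ {k : ℕ} {Q : Dyadic n} (hQ : Q ∈ generation ch F₀ k)
    {x : Fin n → ℝ} (hx : x ∈ Q.cube.toSet \ union (ch Q)) :
    x ∉ union (generation ch F₀ (k + 1)) := by
  intro h
  obtain ⟨R, hR, hxR⟩ := mem_union.1 h
  obtain ⟨Q', hQ', hRQ'⟩ := mem_generation_succ.1 hR
  obtain rfl := generation_eq_of_mem hsub hdisj hF₀ hQ hQ' hx.1 (hsub _ _ hRQ' hxR)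
  exact hx.2 (mem_union.2 ⟨R, hRQ', hxR⟩)

include hsub hdisj hF₀ in
-- Inside `Q`, later generations live in the children of `Q`. By induction they fill at most a
-- fraction `2^{-k}` of each child, and the children fill at most half of `Q`.
lemma volume_inter_union_generation_le (hvol : ∀ Q, 2 * volume (union (ch Q)) ≤ volume Q.cube.toSet)
    (k : ℕ) : ∀ (j : ℕ), ∀ Q ∈ generation ch F₀ j,
      2 ^ k * volume (Q.cube.toSet ∩ union (generation ch F₀ (j + k))) ≤ volume Q.cube.toSet := by
  induction k with
  | zero =>
    intro j Q _
    rw [pow_zero, one_mul]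
    exact measure_mono inter_subset_left
  | succ k ih =>
    intro j Q hQ
    have hcov : Q.cube.toSet ∩ union (generation ch F₀ (j + (k + 1))) ⊆
        ⋃ R ∈ ch Q, R.cube.toSet ∩ union (generation ch F₀ (j + 1 + k)) := by
      rintro x ⟨hxQ, hx⟩
      rw [show j + (k + 1) = j + 1 + k by ring] at hx
      by_cases h : x ∈ union (ch Q)
      · obtain ⟨R, hR, hxR⟩ := mem_union.1 h
        exact mem_biUnion hR ⟨hxR, hx⟩
      · exact absurd (union_generation_antitone hsub (by omega : j + 1 ≤ j + 1 + k) hx)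
          (notMem_union_generation_succ hsub hdisj hF₀ hQ ⟨hxQ, h⟩)
    calc 2 ^ (k + 1) * volume (Q.cube.toSet ∩ union (generation ch F₀ (j + (k + 1))))
        ≤ 2 ^ (k + 1) * ∑' R : ch Q,
            volume ((R : Dyadic n).cube.toSet ∩ union (generation ch F₀ (j + 1 + k))) := by
          gcongr
          exact (measure_mono hcov).trans (measure_biUnion_le _ (ch Q).to_countable _)
      _ = 2 * ∑' R : ch Q, 2 ^ k *
            volume ((R : Dyadic n).cube.toSet ∩ union (generation ch F₀ (j + 1 + k))) := by
          rw [ENNReal.tsum_mul_left, pow_succ]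
          ring
      _ ≤ 2 * ∑' R : ch Q, volume (R : Dyadic n).cube.toSet := by
          gcongr with R
          exact ih (j + 1) R (mem_generation_succ.2 ⟨Q, hQ, R.2⟩)
      _ = 2 * volume (union (ch Q)) := by rw [volume_union (hdisj Q)]
      _ ≤ volume Q.cube.toSet := hvol Q

include hsub hdisj hF₀ in
-- Geometric decay makes the points of infinitely many generations a null set in each of the
-- countably many initial cubes, so the iteration stops almost everywhere.
lemma ae_exists_notMem_union_generation
    (hvol : ∀ Q, 2 * volume (union (ch Q)) ≤ volume Q.cube.toSet) :
    ∀ᵐ x : Fin n → ℝ, ∃ k, x ∉ union (generation ch F₀ k) := by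
  have hnull : ∀ Q ∈ F₀,
      volume (Q.cube.toSet ∩ ⋂ k, union (generation ch F₀ k)) = 0 := by
    intro Q hQ
    by_contra hne
    have hle : ∀ k : ℕ, 2 ^ k * volume (Q.cube.toSet ∩ ⋂ k, union (generation ch F₀ k)) ≤
        volume Q.cube.toSet := by
      intro k
      refine le_trans ?_ (volume_inter_union_generation_le hsub hdisj hF₀ hvol k 0 Q hQ)
      rw [zero_add]
      gcongr
      exact iInter_subset _ k
    have htop : Tendsto (fun k : ℕ => (2 : ℝ≥0∞) ^ k *
        volume (Q.cube.toSet ∩ ⋂ k, union (generation ch F₀ k))) atTop (𝓝 ∞) := by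
      have := ENNReal.Tendsto.mul_const
        (ENNReal.tendsto_pow_atTop_nhds_top_iff.2 (by norm_num : (1 : ℝ≥0∞) < 2))
        (b := volume (Q.cube.toSet ∩ ⋂ k, union (generation ch F₀ k))) (Or.inl (by simp))
      rwa [ENNReal.top_mul hne] at this
    exact Q.cube.volume_toSet_ne_top (top_le_iff.1 (le_of_tendsto' htop hle))
  have : ∀ᵐ x : Fin n → ℝ, ∀ Q ∈ F₀, x ∉ Q.cube.toSet ∩ ⋂ k, union (generation ch F₀ k) := by
    rw [ae_ball_iff F₀.to_countable]
    exact fun Q hQ => measure_eq_zero_iff_ae_notMem.1 (hnull Q hQ)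
  filter_upwards [this] with x hx
  by_contra! h
  obtain ⟨Q, hQ, hxQ⟩ := mem_union.1 (h 0)
  exact hx Q hQ ⟨hxQ, mem_iInter.2 h⟩

include hsub hdisj hF₀ in
/-- Iteration of a local domination estimate: the descendants of `F₀` form a sparse family that
dominates the functions `τ Q`, `Q ∈ F₀`. -/
theorem exists_sparse_of_children
    (hvol : ∀ Q, 2 * volume (union (ch Q)) ≤ volume Q.cube.toSet)
    (a : Dyadic n → ℝ≥0∞) (τ : Dyadic n → (Fin n → ℝ) → ℝ≥0∞)
    (hin : ∀ Q, ∀ᵐ x : Fin n → ℝ, ∀ R ∈ ch Q, x ∈ R.cube.toSet → τ Q x ≤ a Q + τ R x)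
    (hout : ∀ Q, ∀ᵐ x : Fin n → ℝ, x ∈ Q.cube.toSet \ union (ch Q) → τ Q x ≤ a Q) :
    ∃ F : Set (Dyadic n), (∃ E : Dyadic n → Set (Fin n → ℝ), (∀ Q, MeasurableSet (E Q) ∧
      E Q ⊆ Q.cube.toSet ∧ volume Q.cube.toSet ≤ 2 * volume (E Q)) ∧ F.PairwiseDisjoint E) ∧
      ∀ᵐ x : Fin n → ℝ, ∀ Q ∈ F₀, x ∈ Q.cube.toSet →
        τ Q x ≤ ∑' P : F, (P : Dyadic n).cube.toSet.indicator (fun _ => a P) x := by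
  set G := generation ch F₀
  let E : Dyadic n → Set (Fin n → ℝ) := fun Q => Q.cube.toSet \ union (ch Q)
  have hEvol : ∀ Q, volume Q.cube.toSet ≤ 2 * volume (E Q) := by
    intro Q
    have h1 : volume Q.cube.toSet ≤ volume (E Q) + volume (union (ch Q)) :=
      (measure_mono (by intro x hx; by_cases h : x ∈ union (ch Q) <;> simp [E, h, hx])).trans
        (measure_union_le _ _)
    have h2 : 2 * volume Q.cube.toSet ≤ 2 * volume (E Q) + volume Q.cube.toSet :=
      calc 2 * volume Q.cube.toSet ≤ 2 * (volume (E Q) + volume (union (ch Q))) := by gcongr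
        _ = 2 * volume (E Q) + 2 * volume (union (ch Q)) := mul_add _ _ _
        _ ≤ _ := by gcongr; exact hvol Q
    rw [two_mul] at h2
    exact (ENNReal.add_le_add_iff_right Q.cube.volume_toSet_ne_top).1 h2
  -- Together with `hlevel`, nonemptiness forbids a cube to occur in two generations; hence summing
  -- by generations counts no cube twice.
  have hEne : ∀ Q, (E Q).Nonempty := by
    intro Q
    rw [nonempty_iff_ne_empty]
    intro h
    have := hEvol Q
    rw [h, measure_empty, mul_zero] at this
    exact Q.cube.volume_toSet_ne_zero (le_zero_iff.1 this)
  have hlevel : ∀ {j k : ℕ} {Q Q' : Dyadic n} {x : Fin n → ℝ}, Q ∈ G j → Q' ∈ G k →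
      x ∈ E Q → x ∈ E Q' → j = k := by
    have aux : ∀ {j k : ℕ} {Q Q' : Dyadic n} {x : Fin n → ℝ}, Q ∈ G j → Q' ∈ G k →
        x ∈ E Q → x ∈ E Q' → ¬ j < k := by
      intro j k Q Q' x hQ hQ' hx hx' hjk
      exact notMem_union_generation_succ hsub hdisj hF₀ hQ hx
        (union_generation_antitone hsub (Nat.succ_le_of_lt hjk) (mem_union.2 ⟨Q', hQ', hx'.1⟩))
    intro j k Q Q' x hQ hQ' hx hx'
    have := aux hQ hQ' hx hx'
    have := aux hQ' hQ hx' hx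
    omega
  refine ⟨⋃ k, G k, ⟨E, fun Q => ⟨Q.cube.measurableSet_toSet.diff (measurableSet_union _),
    sdiff_subset, hEvol Q⟩, ?_⟩, ?_⟩
  · intro Q hQ Q' hQ' hne
    obtain ⟨j, hj⟩ := mem_iUnion.1 hQ
    obtain ⟨k, hk⟩ := mem_iUnion.1 hQ'
    refine Set.disjoint_left.2 fun x hx hx' => hne ?_
    obtain rfl := hlevel hj hk hx hx'
    exact generation_eq_of_mem hsub hdisj hF₀ hj hk hx.1 hx'.1
  filter_upwards [ae_all_iff.2 hin, ae_all_iff.2 hout,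
    ae_exists_notMem_union_generation hsub hdisj hF₀ hvol] with x hxin hxout ⟨K, hK⟩ Q hQ hxQ
  let A : ℕ → ℝ≥0∞ := fun k => ∑' P : G k, (P : Dyadic n).cube.toSet.indicator (fun _ => a P) x
  have hA : ∀ k, ∀ P ∈ G k, x ∈ P.cube.toSet → a P ≤ A k := by
    intro k P hP hxP
    refine le_trans ?_ (ENNReal.le_tsum (⟨P, hP⟩ : G k))
    simp [indicator_of_mem hxP]
  -- `d` bounds the number of generations still to be descended: `x` has left all of them from the
  -- `K`-th on, so the case `d = 0` is void.
  have hchain : ∀ d k, K ≤ k + d → ∀ P ∈ G k, x ∈ P.cube.toSet →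
      τ P x ≤ ∑ i ∈ Finset.range d, A (k + i) := by
    intro d
    induction d with
    | zero =>
      intro k hk P hP hxP
      exact absurd (union_generation_antitone hsub hk (mem_union.2 ⟨P, hP, hxP⟩)) hK
    | succ d ih =>
      intro k hk P hP hxP
      rw [Finset.sum_range_succ', add_comm]
      by_cases h : x ∈ union (ch P)
      · obtain ⟨R, hR, hxR⟩ := mem_union.1 h
        refine (hxin P R hR hxR).trans (add_le_add (hA k P hP hxP) ?_)
        refine (ih (k + 1) (by omega) R (mem_generation_succ.2 ⟨P, hP, hR⟩) hxR).trans_eq ?_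
        exact Finset.sum_congr rfl fun i _ => by congr 1; ring
      · exact (hxout P ⟨hxP, h⟩).trans ((hA k P hP hxP).trans le_self_add)
  refine (hchain K 0 (by omega) Q hQ hxQ).trans ?_
  calc ∑ i ∈ Finset.range K, A (0 + i) ≤ ∑' k, A k := by
        simp only [zero_add]
        exact ENNReal.sum_le_tsum _
    _ = ∑' P : Σ k, G k, (P.2 : Dyadic n).cube.toSet.indicator (fun _ => a P.2) x :=
        (ENNReal.tsum_sigma' fun P : Σ k, G k =>
          (P.2 : Dyadic n).cube.toSet.indicator (fun _ => a P.2) x).symm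
    _ ≤ _ := by
        let φ : (Σ k, G k) → ⋃ k, G k := fun P => ⟨P.2, mem_iUnion.2 ⟨P.1, P.2.2⟩⟩
        have hφ : Function.Injective φ := by
          rintro ⟨j, P, hP⟩ ⟨k, P', hP'⟩ h
          obtain rfl : P = P' := congrArg Subtype.val h
          obtain ⟨y, hy⟩ := hEne P
          obtain rfl := hlevel hP hP' hy hy
          rfl
        exact ENNReal.tsum_comp_le_tsum_of_injective hφ
          fun P => (P : Dyadic n).cube.toSet.indicator (fun _ => a P) x

end

/-- There is a partition of `ℝⁿ` into dyadic cubes `Q` such that all the dilates `5Q` contain a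
given cube centred at the origin. -/
theorem exists_partition (n N : ℕ) : ∃ F₀ : Set (Dyadic n),
    (F₀.PairwiseDisjoint fun Q => Q.cube.toSet) ∧ (∀ x, ∃ Q ∈ F₀, x ∈ Q.cube.toSet) ∧
    ∀ Q ∈ F₀, ∀ y : Fin n → ℝ, (∀ l, |y l| < 2 ^ N) → y ∈ Q.cube.five.toSet := by
  -- With `s = 2^{N+i}`, this says that `x` lies in `[-2s, 2s)ⁿ`. Each point gets its dyadic cube of
  -- the least such scale. An index between -2 and 1 is exactly what lets the fivefold dilate, which
  -- reaches two sides further in each direction, contain `(-s, s)ⁿ`.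
  let p : (Fin n → ℝ) → ℕ → Prop := fun x i => ∀ l, -2 ≤ ⌊x l / 2 ^ ((N : ℤ) + i)⌋ ∧
    ⌊x l / 2 ^ ((N : ℤ) + i)⌋ ≤ 1
  have hp : ∀ x i, p x i ↔ ∀ l, -(2 * 2 ^ ((N : ℤ) + i)) ≤ x l ∧
      x l < 2 * (2 : ℝ) ^ ((N : ℤ) + i) := by
    intro x i
    refine forall_congr' fun l => ?_
    have hpos : (0 : ℝ) < 2 ^ ((N : ℤ) + i) := by positivity
    rw [Int.le_floor, ← Int.lt_add_one_iff, Int.floor_lt, le_div_iff₀ hpos, div_lt_iff₀ hpos]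
    push_cast
    constructor <;> rintro ⟨h1, h2⟩ <;> constructor <;> linarith
  have hex : ∀ x, ∃ i, p x i := by
    intro x
    obtain ⟨i, hi⟩ := pow_unbounded_of_one_lt (‖x‖) (by norm_num : (1 : ℝ) < 2)
    refine ⟨i, (hp x i).2 fun l => ?_⟩
    have h1 : |x l| ≤ ‖x‖ := norm_le_pi_norm x l
    have h2 : (2 : ℝ) ^ i ≤ 2 ^ ((N : ℤ) + i) := by
      rw [← zpow_natCast]
      exact zpow_le_zpow_right₀ (by norm_num) (by omega)
    have h3 : (0 : ℝ) < 2 ^ ((N : ℤ) + i) := by positivity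
    have := abs_le.1 h1
    constructor <;> linarith
  classical
  let κ : (Fin n → ℝ) → ℕ := fun x => Nat.find (hex x)
  let cell : (Fin n → ℝ) → Dyadic n := fun x => containing ((N : ℤ) + κ x) x
  have hcongr : ∀ {x y : Fin n → ℝ} {i : ℕ},
      containing ((N : ℤ) + i) x = containing ((N : ℤ) + i) y → p x i → p y i := by
    intro x y i h hx l
    have hl : ⌊x l / 2 ^ ((N : ℤ) + i)⌋ = ⌊y l / 2 ^ ((N : ℤ) + i)⌋ :=
      congrFun (congrArg Prod.snd h) l
    rw [← hl]
    exact hx l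
  -- The least scale is constant on a cell: if one point qualifies at a smaller scale, the cell has
  -- indices -1 or 0, so all of it qualifies at scale `i - 1`.
  have hprev : ∀ {x y : Fin n → ℝ} {i i' : ℕ}, i' < i →
      containing ((N : ℤ) + i) x = containing ((N : ℤ) + i) y → p x i' → p y (i - 1) := by
    intro x y i i' hi h hx
    rw [hp] at hx ⊢
    intro l
    have hpos : (0 : ℝ) < 2 ^ ((N : ℤ) + i) := by positivity
    have e1 : 2 * (2 : ℝ) ^ ((N : ℤ) + ((i - 1 : ℕ) : ℤ)) = 2 ^ ((N : ℤ) + i) := by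
      rw [← zpow_one_add₀ (by norm_num)]
      congr 1
      omega
    have e2 : 2 * (2 : ℝ) ^ ((N : ℤ) + i') ≤ 2 ^ ((N : ℤ) + i) := by
      rw [← zpow_one_add₀ (by norm_num)]
      exact zpow_le_zpow_right₀ (by norm_num) (by omega)
    have hl : ⌊x l / 2 ^ ((N : ℤ) + i)⌋ = ⌊y l / 2 ^ ((N : ℤ) + i)⌋ :=
      congrFun (congrArg Prod.snd h) l
    have hx1 : -1 ≤ ⌊x l / 2 ^ ((N : ℤ) + i)⌋ := by
      rw [Int.le_floor, le_div_iff₀ hpos]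
      push_cast
      linarith [(hx l).1]
    have hx2 : ⌊x l / 2 ^ ((N : ℤ) + i)⌋ < 1 := by
      rw [Int.floor_lt, div_lt_iff₀ hpos]
      push_cast
      linarith [(hx l).2]
    rw [hl] at hx1 hx2
    rw [Int.le_floor, le_div_iff₀ hpos] at hx1
    rw [Int.floor_lt, div_lt_iff₀ hpos] at hx2
    push_cast at hx1 hx2
    rw [e1]
    constructor <;> linarith
  have hcell : ∀ {x z : Fin n → ℝ}, z ∈ (cell x).cube.toSet → cell z = cell x := by
    intro x z hz
    have hz' := mem_containing_iff.1 hz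
    have hκ : κ z = κ x := by
      refine (Nat.find_eq_iff _).2 ⟨hcongr hz'.symm (Nat.find_spec (hex x)), fun i hi hzi => ?_⟩
      have hpx := hprev hi hz' hzi
      exact Nat.find_min (hex x) (m := κ x - 1) (by change κ x - 1 < κ x; omega) hpx
    change containing ((N : ℤ) + κ z) z = _
    rw [hκ]
    exact hz'
  refine ⟨range cell, ?_, fun x => ⟨cell x, mem_range_self x, mem_containing _ x⟩, ?_⟩
  · rintro _ ⟨x, rfl⟩ _ ⟨y, rfl⟩ hne
    exact Set.disjoint_left.2 fun z hzx hzy => hne ((hcell hzx).symm.trans (hcell hzy))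
  · rintro _ ⟨x, rfl⟩ y hy
    have hx : p x (κ x) := Nat.find_spec (hex x)
    rw [Cube.mem_toSet]
    intro l
    have hpos : (0 : ℝ) < 2 ^ ((N : ℤ) + κ x) := by positivity
    have hN : (2 : ℝ) ^ N ≤ 2 ^ ((N : ℤ) + κ x) := by
      rw [← zpow_natCast]
      exact zpow_le_zpow_right₀ (by norm_num) (by omega)
    have hyl := abs_lt.1 (hy l)
    have h1 : (-2 : ℝ) ≤ (⌊x l / 2 ^ ((N : ℤ) + κ x)⌋ : ℝ) := by exact_mod_cast (hx l).1
    have h2 : (⌊x l / 2 ^ ((N : ℤ) + κ x)⌋ : ℝ) ≤ 1 := by exact_mod_cast (hx l).2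
    simp only [Cube.five, Cube.dilate, cube, cell, containing]
    constructor <;> nlinarith

end Dyadic

/-- Tonelli's theorem for a product of functions of one variable. -/
theorem lintegral_pi_prod {α : Type*} [MeasurableSpace α] {m : ℕ} (μ : Fin m → Measure α)
    [∀ i, SigmaFinite (μ i)] {g : Fin m → α → ℝ≥0∞} (hg : ∀ i, AEMeasurable (g i) (μ i)) :
    ∫⁻ y : Fin m → α, ∏ i, g i (y i) ∂Measure.pi μ = ∏ i, ∫⁻ y, g i y ∂μ i := by
  induction m with
  | zero => simp
  | succ m ih =>
    have hprod : AEMeasurable (fun y : Fin m → α => ∏ i, g i.succ (y i))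
        (Measure.pi fun i => μ i.succ) :=
      Finset.aemeasurable_fun_prod _ fun i _ =>
        (hg i.succ).comp_quasiMeasurePreserving (Measure.quasiMeasurePreserving_eval _ i)
    calc ∫⁻ y : Fin (m + 1) → α, ∏ i, g i (y i) ∂Measure.pi μ
        = ∫⁻ z : α × (Fin m → α), g 0 z.1 * ∏ i, g i.succ (z.2 i)
            ∂(μ 0).prod (Measure.pi fun i => μ i.succ) := by
          have e := measurePreserving_piFinSuccAbove μ 0
          rw [← e.symm.lintegral_comp_emb (MeasurableEquiv.measurableEmbedding _)]
          simp_rw [MeasurableEquiv.piFinSuccAbove_symm_apply, Fin.insertNthEquiv,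
            Fin.prod_univ_succ, Fin.insertNth_zero, Equiv.coe_fn_mk, Fin.cons_succ,
            Fin.zero_succAbove, Fin.cons_zero]
          rfl
      _ = ∏ i, ∫⁻ y, g i y ∂μ i := by
          rw [lintegral_prod_mul (hg 0) hprod, ih _ fun i => hg i.succ, Fin.prod_univ_succ]

/-! ### Hölder's inequality on annuli and the Hörmander constant -/

variable {𝕜 : Type*} [RCLike 𝕜] {n m : ℕ} {r : ℝ}

lemma eLpNorm_eq_lintegral_enorm {α : Type*} [MeasurableSpace α] {μ : Measure α} (hr : 1 ≤ r)
    (f : α → 𝕜) : eLpNorm f (ENNReal.ofReal r) μ = (∫⁻ y, ‖f y‖ₑ ^ r ∂μ) ^ (1 / r) := by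
  have h0 : ENNReal.ofReal r ≠ 0 := by simp; linarith
  rw [eLpNorm_eq_lintegral_rpow_enorm_toReal h0 ENNReal.ofReal_ne_top,
    ENNReal.toReal_ofReal (by linarith)]

lemma prod_rpow_lintegral_enorm (hr : 1 ≤ r) {D : Set (Fin n → ℝ)}
    {f : Fin m → (Fin n → ℝ) → 𝕜} (hf : ∀ i, AEStronglyMeasurable (f i) volume) :
    (∫⁻ y in Set.univ.pi fun _ : Fin m => D, (∏ i, ‖f i (y i)‖ₑ) ^ r) ^ (1 / r) =
      ∏ i, (∫⁻ y in D, ‖f i y‖ₑ ^ r) ^ (1 / r) := by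
  have hr0 : 0 ≤ r := by linarith
  rw [ENNReal.prod_rpow_of_nonneg (by positivity), volume_pi, Measure.restrict_pi_pi]
  simp_rw [← ENNReal.prod_rpow_of_nonneg hr0]
  rw [lintegral_pi_prod (fun _ => volume.restrict D) (g := fun i y => ‖f i y‖ₑ ^ r)]
  exact fun i => ((hf i).enorm.pow_const r).restrict

/-- The difference of the values at two points of an integral operator, applied to a function
that vanishes near the diagonal, is controlled by the Hörmander constant. -/
theorem enorm_integral_sub_le (hr : 1 ≤ r) (K : (Fin n → ℝ) → (Fin m → Fin n → ℝ) → 𝕜)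
    (Q : Cube n) {x z : Fin n → ℝ} (hx : x ∈ Q.half.toSet) (hz : z ∈ Q.half.toSet)
    {F : (Fin m → Fin n → ℝ) → 𝕜} (hF : AEStronglyMeasurable F volume)
    (hF0 : ∀ y ∈ Q.power m, F y = 0) {f : Fin m → (Fin n → ℝ) → 𝕜}
    (hf : ∀ i, AEStronglyMeasurable (f i) volume) (hFf : ∀ y, ‖F y‖ₑ ≤ ∏ i, ‖f i (y i)‖ₑ)
    (hix : Integrable fun y => K x y * F y) (hiz : Integrable fun y => K z y * F y) {M : ℝ≥0∞}
    (hM : ∀ k : ℕ, ∏ i, (∫⁻ y in (Q.twoPow (k + 1)).toSet, ‖f i y‖ₑ ^ r) ^ (1 / r) ≤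
      volume (Q.twoPow (k + 1)).toSet ^ ((m : ℝ) / r) * M) :
    ‖(∫ y, K x y * F y) - ∫ y, K z y * F y‖ₑ ≤ hormanderConst r K * M := by
  have hr0 : 0 < r := by linarith
  let D : ℕ → Set (Fin m → Fin n → ℝ) := fun k =>
    (Q.twoPow (k + 1)).power m \ (Q.twoPow k).power m
  have hpow0 : (Q.twoPow 0).power m = Q.power m := by
    have : Q.twoPow 0 = Q := by ext <;> simp [Cube.twoPow, Cube.dilate]
    rw [this]
  have hmeas : ∀ P : Cube n, MeasurableSet (P.power m) := fun P =>
    MeasurableSet.univ_pi fun _ => P.measurableSet_toSet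
  have hcov : (Q.power m)ᶜ ⊆ ⋃ k, D k := by
    intro y hy
    have hex : ∃ k, y ∈ (Q.twoPow k).power m := by
      obtain ⟨k, hk⟩ := pow_unbounded_of_one_lt (2 * ‖y - fun _ => Q.center‖ / Q.side)
        (by norm_num : (1 : ℝ) < 2)
      refine ⟨k, fun i _ => Cube.mem_toSet.2 fun l => ?_⟩
      have h1 : |y i l - Q.center l| ≤ ‖y - fun _ => Q.center‖ :=
        (norm_le_pi_norm (y i - Q.center) l).trans (norm_le_pi_norm (y - fun _ => Q.center) i)
      rw [div_lt_iff₀ Q.side_pos] at hk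
      have := abs_le.1 h1
      simp only [Cube.twoPow, Cube.dilate]
      constructor <;> linarith
    classical
    rcases hk : Nat.find hex with _ | k
    · refine absurd ?_ hy
      rw [← hpow0, ← hk]
      exact Nat.find_spec hex
    · refine mem_iUnion.2 ⟨k, ?_, Nat.find_min hex (by omega)⟩
      rw [← hk]
      exact Nat.find_spec hex
  -- No measurability of `K x` is assumed, only integrability of `K x y * F y`. `H` is a measurable
  -- substitute for `K x - K z`: it agrees with it where `F ≠ 0` and is 0 elsewhere, since `0⁻¹ =
  -- 0`.
  let H : (Fin m → Fin n → ℝ) → 𝕜 := fun y => (K x y * F y - K z y * F y) * (F y)⁻¹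
  have hHF : ∀ y, H y * F y = K x y * F y - K z y * F y := by
    intro y
    by_cases h : F y = 0
    · simp [h]
    · simp only [H]
      field_simp
  have hHle : ∀ y, ‖H y‖ ≤ ‖K x y - K z y‖ := by
    intro y
    by_cases h : F y = 0
    · simp [H, h]
    · apply le_of_eq
      simp only [H]
      congr 1
      field_simp
  have hHmeas : AEStronglyMeasurable H volume :=
    (hix.aestronglyMeasurable.sub hiz.aestronglyMeasurable).mul
      hF.aemeasurable.inv.aestronglyMeasurable
  have hann : ∀ k, ∫⁻ y in D k, ‖H y * F y‖ₑ ≤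
      eLpNorm (fun y => K x y - K z y) (ENNReal.conjExponent (ENNReal.ofReal r))
        (volume.restrict (D k)) * (volume (Q.twoPow (k + 1)).toSet ^ ((m : ℝ) / r) * M) := by
    intro k
    have : ENNReal.HolderConjugate (ENNReal.conjExponent (ENNReal.ofReal r)) (ENNReal.ofReal r) :=
      (ENNReal.HolderConjugate.conjExponent (by simpa using hr)).symm
    have h1 := eLpNorm_smul_le_mul_eLpNorm (r := 1) (hF.restrict (s := D k))
      (hHmeas.restrict (s := D k)) (p := ENNReal.conjExponent (ENNReal.ofReal r))
      (q := ENNReal.ofReal r)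
    rw [eLpNorm_one_eq_lintegral_enorm] at h1
    refine h1.trans (mul_le_mul' (eLpNorm_mono hHle) (le_trans ?_ (hM k)))
    rw [← prod_rpow_lintegral_enorm hr hf, eLpNorm_eq_lintegral_enorm hr]
    gcongr
    · exact sdiff_subset
    · exact hFf _
  calc ‖(∫ y, K x y * F y) - ∫ y, K z y * F y‖ₑ
      = ‖∫ y, H y * F y‖ₑ := by rw [← integral_sub hix hiz]; simp_rw [hHF]
    _ ≤ ∫⁻ y, ‖H y * F y‖ₑ := enorm_integral_le_lintegral_enorm _
    _ = ∫⁻ y in (Q.power m)ᶜ, ‖H y * F y‖ₑ := by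
        rw [← lintegral_add_compl _ (hmeas Q),
          setLIntegral_congr_fun (g := fun _ => 0) (hmeas Q) fun y hy => by simp [hF0 y hy]]
        simp
    _ ≤ ∫⁻ y in ⋃ k, D k, ‖H y * F y‖ₑ := lintegral_mono_set hcov
    _ ≤ ∑' k, ∫⁻ y in D k, ‖H y * F y‖ₑ := lintegral_iUnion_le _ _
    _ ≤ ∑' k, (volume (Q.twoPow (k + 1)).toSet ^ ((m : ℝ) / r) *
          eLpNorm (fun y => K x y - K z y) (ENNReal.conjExponent (ENNReal.ofReal r))
            (volume.restrict (D k))) * M := by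
        gcongr with k
        refine (hann k).trans_eq ?_
        ring
    _ ≤ hormanderConst r K * M := by
        rw [ENNReal.tsum_mul_right]
        gcongr
        exact le_iSup_of_le Q (le_iSup₂_of_le x hx (le_iSup₂_of_le z hz le_rfl))

/-! ### Weak norms, convergence in measure and continuity of `T` -/

section weakNorm

variable {p : ℝ}

lemma mul_rpow_volume_le_weakNorm (p : ℝ) (g : (Fin n → ℝ) → 𝕜) (t : ℝ≥0) :
    (t : ℝ≥0∞) * volume {x | (t : ℝ≥0∞) < ‖g x‖ₑ} ^ (1 / p) ≤ weakNorm p g :=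
  le_iSup (fun t : ℝ≥0 => (t : ℝ≥0∞) * volume {x | (t : ℝ≥0∞) < ‖g x‖ₑ} ^ (1 / p)) t

/-- Chebyshev's inequality for the weak norm. -/
lemma volume_lt_enorm_le (hp : 0 < p) (g : (Fin n → ℝ) → 𝕜) {t : ℝ≥0} (ht : t ≠ 0) :
    volume {x | (t : ℝ≥0∞) < ‖g x‖ₑ} ≤ (weakNorm p g / t) ^ p := by
  have h := mul_rpow_volume_le_weakNorm p g t
  rw [mul_comm, ← ENNReal.le_div_iff_mul_le (Or.inl (by simpa using ht)) (Or.inl (by simp))] at h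
  have := ENNReal.rpow_le_rpow h hp.le
  rwa [← ENNReal.rpow_mul, one_div_mul_cancel hp.ne', ENNReal.rpow_one] at this

lemma ae_eq_zero_of_weakNorm_eq_zero (hp : 0 < p) {g : (Fin n → ℝ) → 𝕜} (h : weakNorm p g = 0) :
    ∀ᵐ x, g x = 0 := by
  have h1 : ∀ k : ℕ, ∀ᵐ x, ‖g x‖ₑ ≤ (((k : ℝ≥0) + 1)⁻¹ : ℝ≥0) := by
    intro k
    have := volume_lt_enorm_le hp g (t := ((k : ℝ≥0) + 1)⁻¹) (by positivity)
    rw [h, ENNReal.zero_div, ENNReal.zero_rpow_of_pos hp, le_zero_iff] at this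
    rw [ae_iff]
    simpa only [not_le] using this
  filter_upwards [ae_all_iff.2 h1] with x hx
  have hlim : Tendsto (fun k : ℕ => (((((k : ℝ≥0) + 1)⁻¹ : ℝ≥0)) : ℝ≥0∞)) atTop (𝓝 0) := by
    have h2 : Tendsto (fun k : ℕ => (((k : ℝ≥0) + 1)⁻¹ : ℝ≥0)) atTop (𝓝 0) := by
      simpa using tendsto_one_div_add_atTop_nhds_zero_nat (𝕜 := ℝ≥0)
    rw [← ENNReal.coe_zero]
    exact ENNReal.tendsto_coe.2 h2
  simpa using le_of_tendsto_of_tendsto' tendsto_const_nhds hlim hx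

/-- The level set of a function at a multiple of its normalized weak norm is small. -/
theorem volume_lt_enorm_le_of_weakNorm_le (hp : 0 < p) {g : (Fin n → ℝ) → 𝕜} {B V : ℝ≥0∞}
    (hB : B ≠ ∞) (hg : weakNorm p g ≤ B * V ^ (1 / p)) {s : ℝ≥0} (hs : s ≠ 0) :
    volume {x | s * B < ‖g x‖ₑ} ≤ V / (s : ℝ≥0∞) ^ p := by
  -- For `B = 0` the level is 0 and Chebyshev's inequality is unavailable, but then `g` vanishes
  -- almost everywhere.
  by_cases hB0 : B = 0
  · subst hB0
    have h0 := ae_eq_zero_of_weakNorm_eq_zero hp (le_zero_iff.1 (by simpa using hg))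
    have : volume {x | s * 0 < ‖g x‖ₑ} = 0 := by
      refine measure_mono_null (fun x hx => ?_) (ae_iff.1 h0)
      simpa using hx
    rw [this]
    exact zero_le
  · lift B to ℝ≥0 using hB
    have hB0' : B ≠ 0 := by simpa using hB0
    have h := volume_lt_enorm_le hp g (mul_ne_zero hs hB0')
    push_cast at h
    refine h.trans ?_
    calc (weakNorm p g / (s * B)) ^ p ≤ (B * V ^ (1 / p) / (s * B)) ^ p := by gcongr
      _ = (V ^ (1 / p) / s) ^ p := by
          congr 1
          rw [mul_comm (s : ℝ≥0∞), ENNReal.mul_div_mul_left _ _ hB0 (by simp)]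
      _ = V / (s : ℝ≥0∞) ^ p := by
          rw [ENNReal.div_rpow_of_nonneg _ _ hp.le, ← ENNReal.rpow_mul,
            one_div_mul_cancel hp.ne', ENNReal.rpow_one]

lemma tendstoInMeasure_of_weakNorm (hp : 0 < p) {g : ℕ → (Fin n → ℝ) → 𝕜}
    (hg : Tendsto (fun N => weakNorm p (g N)) atTop (𝓝 0)) :
    TendstoInMeasure volume g atTop (0 : (Fin n → ℝ) → 𝕜) := by
  rw [tendstoInMeasure_iff_enorm]
  intro ε hε hε'
  lift ε to ℝ≥0 using hε'
  have hε0 : ε ≠ 0 := by simpa using hε.ne'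
  -- The weak norm controls strict superlevel sets, convergence in measure asks for `ε ≤ ‖g‖`; hence
  -- the level `ε / 2`.
  have hε2 : ε / 2 ≠ 0 := by positivity
  have hlim : Tendsto (fun N => (weakNorm p (g N) / (ε / 2 : ℝ≥0)) ^ p) atTop (𝓝 0) := by
    have h1 : Tendsto (fun N => weakNorm p (g N) / (ε / 2 : ℝ≥0)) atTop (𝓝 0) := by
      simpa using ENNReal.Tendsto.div_const hg (Or.inr (by simpa using hε2))
    have h2 := (ENNReal.continuous_rpow_const (y := p)).tendsto 0
    rw [ENNReal.zero_rpow_of_pos hp] at h2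
    exact h2.comp h1
  refine tendsto_of_tendsto_of_tendsto_of_le_of_le tendsto_const_nhds hlim (fun _ => zero_le)
    fun N => le_trans (measure_mono fun x hx => ?_) (volume_lt_enorm_le hp (g N) hε2)
  simp only [Pi.zero_apply, sub_zero, mem_ofPred_eq] at hx ⊢
  refine lt_of_lt_of_le ?_ hx
  exact_mod_cast NNReal.half_lt_self hε0

end weakNorm

lemma tendstoInMeasure_finset_sum {α ι : Type*} [MeasurableSpace α] {μ : Measure α}
    (s : Finset ι) {g : ι → ℕ → α → 𝕜}
    (hg : ∀ i ∈ s, TendstoInMeasure μ (g i) atTop (0 : α → 𝕜)) :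
    TendstoInMeasure μ (fun N x => ∑ i ∈ s, g i N x) atTop (0 : α → 𝕜) := by
  classical
  induction s using Finset.induction_on with
  | empty =>
    rw [tendstoInMeasure_iff_enorm]
    intro ε hε _
    simp [hε.not_ge]
  | insert a s ha ih =>
    have h1 := tendstoInMeasure_iff_enorm.1 (hg a (Finset.mem_insert_self a s))
    have h2 := tendstoInMeasure_iff_enorm.1
      (ih fun i hi => hg i (Finset.mem_insert_of_mem hi))
    rw [tendstoInMeasure_iff_enorm]
    intro ε hε hε'
    have hε2 : 0 < ε / 2 := ENNReal.half_pos hε.ne'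
    have hε2' : ε / 2 ≠ ∞ := (ENNReal.div_lt_top hε' (by simp)).ne
    have hlim := (h1 _ hε2 hε2').add (h2 _ hε2 hε2')
    rw [add_zero] at hlim
    refine tendsto_of_tendsto_of_tendsto_of_le_of_le tendsto_const_nhds hlim (fun _ => zero_le)
      fun N => le_trans (measure_mono fun x hx => ?_) (measure_union_le _ _)
    simp only [Pi.zero_apply, sub_zero, mem_ofPred_eq, mem_union] at hx ⊢
    by_contra! h
    rw [Finset.sum_insert ha] at hx
    have h3 := hx.trans (enorm_add_le _ _)
    have h4 := ENNReal.add_lt_add h.1 h.2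
    rw [ENNReal.add_halves] at h4
    exact absurd h3 h4.not_ge

lemma coeFn_finset_sum {α ι : Type*} [MeasurableSpace α] {μ : Measure α} (s : Finset ι)
    (F : ι → α →ₘ[μ] 𝕜) : ⇑(∑ i ∈ s, F i) =ᵐ[μ] fun x => ∑ i ∈ s, F i x := by
  classical
  induction s using Finset.induction_on with
  | empty =>
    simp only [Finset.sum_empty]
    exact AEEqFun.coeFn_zero
  | insert a s ha ih =>
    simp_rw [Finset.sum_insert ha]
    filter_upwards [AEEqFun.coeFn_add (F a) (∑ i ∈ s, F i), ih] with x h1 h2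
    rw [h1, Pi.add_apply, h2]

/-- The infimum defining `opNorm` is attained: divide by the product of norms. If that product is 0,
any admissible constant will do, and finiteness supplies one. -/
theorem weakNorm_apply_le {T : MultilinearOperator 𝕜 n m r} (hT : opNorm T < ∞)
    (f : Fin m → Lp (α := Fin n → ℝ) 𝕜 (ENNReal.ofReal r) volume) :
    weakNorm (r / m) (T f) ≤ opNorm T * ∏ i, eLpNorm (f i) (ENNReal.ofReal r) volume := by
  set P := ∏ i, eLpNorm (f i) (ENNReal.ofReal r) volume with hP
  have hPtop : P ≠ ∞ := ENNReal.prod_ne_top fun i _ => (Lp.memLp (f i)).eLpNorm_ne_top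
  by_cases hP0 : P = 0
  · obtain ⟨C, hC, -⟩ := sInf_lt_iff.1 hT
    have := hC f
    rw [← hP, hP0, mul_zero] at this
    rw [hP0, mul_zero]
    exact this
  · rw [← ENNReal.div_le_iff hP0 hPtop]
    exact le_sInf fun C hC => ENNReal.div_le_of_le_mul (hC f)

/-- Every remaining term has at least one entry from `V`. This serves twice: with `V` small it gives
continuity in measure, and with `V` supported away from a cube it allows the kernel formula. -/
lemma map_add_sub_map (T : MultilinearOperator 𝕜 n m r)
    (U V : Fin m → Lp (α := Fin n → ℝ) 𝕜 (ENNReal.ofReal r) volume) :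
    T (U + V) - T U = ∑ s ∈ (Finset.univ : Finset (Finset (Fin m))).erase Finset.univ,
      T (s.piecewise U V) := by
  rw [T.map_add_univ, ← Finset.sum_erase_add _ _ (Finset.mem_univ (Finset.univ : Finset (Fin m))),
    Finset.piecewise_univ, add_sub_cancel_right]

lemma exists_notMem_of_mem_erase {s : Finset (Fin m)}
    (hs : s ∈ (Finset.univ : Finset (Finset (Fin m))).erase Finset.univ) : ∃ i, i ∉ s := by
  by_contra! h
  exact (Finset.mem_erase.1 hs).1 (Finset.eq_univ_iff_forall.2 h)

/-- A bounded operator is continuous in measure. -/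
theorem tendstoInMeasure_apply {T : MultilinearOperator 𝕜 n m r} (hr : 1 ≤ r) (hm : 1 ≤ m)
    (hT : opNorm T < ∞) {f : Fin m → (Fin n → ℝ) → 𝕜} {F : ℕ → Fin m → (Fin n → ℝ) → 𝕜}
    (hf : ∀ i, MemLp (f i) (ENNReal.ofReal r) volume)
    (hF : ∀ N i, MemLp (F N i) (ENNReal.ofReal r) volume)
    (hlim : ∀ i, Tendsto (fun N => eLpNorm (F N i - f i) (ENNReal.ofReal r) volume) atTop (𝓝 0)) :
    TendstoInMeasure volume (fun N => ⇑(T fun i => (hF N i).toLp (F N i))) atTop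
      (T fun i => (hf i).toLp (f i)) := by
  have hp : 0 < r / m := div_pos (by linarith) (by exact_mod_cast hm)
  set U : Fin m → Lp (α := Fin n → ℝ) 𝕜 (ENNReal.ofReal r) volume :=
    fun i => (hf i).toLp (f i) with hU
  let V : ℕ → Fin m → Lp (α := Fin n → ℝ) 𝕜 (ENNReal.ofReal r) volume :=
    fun N i => ((hF N i).sub (hf i)).toLp (F N i - f i)
  have hUV : ∀ N, (fun i => (hF N i).toLp (F N i)) = U + V N := by
    intro N
    funext i
    rw [Pi.add_apply, ← MemLp.toLp_add]
    exact MemLp.toLp_congr _ _ (by simp)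
  have hV : ∀ i, Tendsto (fun N => eLpNorm (V N i) (ENNReal.ofReal r) volume) atTop (𝓝 0) := by
    intro i
    refine (hlim i).congr fun N => ?_
    exact eLpNorm_congr_ae (MemLp.coeFn_toLp _).symm
  have hsum := tendstoInMeasure_finset_sum (μ := (volume : Measure (Fin n → ℝ)))
    ((Finset.univ : Finset (Finset (Fin m))).erase Finset.univ)
    (g := fun s N => ⇑(T (s.piecewise U (V N)))) (fun s hs => by
      refine tendstoInMeasure_of_weakNorm hp ?_
      refine tendsto_of_tendsto_of_tendsto_of_le_of_le tendsto_const_nhds ?_ (fun _ => zero_le)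
        fun N => weakNorm_apply_le hT _
      obtain ⟨j, hj⟩ := exists_notMem_of_mem_erase hs
      have hlim : Tendsto (fun N => ∏ i, eLpNorm (s.piecewise U (V N) i) (ENNReal.ofReal r) volume)
          atTop (𝓝 (∏ i, if i ∈ s then eLpNorm (U i) (ENNReal.ofReal r) volume else 0)) := by
        refine ENNReal.tendsto_finsetProd_of_ne_top _ (fun i _ => ?_) fun i _ => ?_
        · by_cases hi : i ∈ s
          · simp [hi]
          · simpa [hi] using hV i
        · split_ifs
          · exact (Lp.memLp _).eLpNorm_ne_top
          · simp
      rw [Finset.prod_eq_zero (Finset.mem_univ j) (by simp [hj])] at hlim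
      simpa using ENNReal.Tendsto.const_mul hlim (Or.inr hT.ne))
  rw [tendstoInMeasure_iff_enorm] at hsum ⊢
  intro ε hε hε'
  refine (hsum ε hε hε').congr fun N => measure_congr ?_
  have h1 := AEEqFun.coeFn_sub (T (U + V N)) (T U)
  rw [map_add_sub_map] at h1
  filter_upwards [h1, coeFn_finset_sum
    ((Finset.univ : Finset (Finset (Fin m))).erase Finset.univ)
    (fun s => T (s.piecewise U (V N)))] with x hx1 hx2
  change (ε ≤ ‖_‖ₑ) = (ε ≤ ‖_‖ₑ)
  rw [hUV, Pi.zero_apply, sub_zero, ← hx2, hx1, Pi.sub_apply]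

/-- The kernel representation of the difference `T(f) - T(f χ_{5R})` in the cube `R`. -/
theorem ae_sub_indicator_eq_integral {T : MultilinearOperator 𝕜 n m r}
    {K : (Fin n → ℝ) → (Fin m → Fin n → ℝ) → 𝕜} (hK : HasKernel T K)
    {f : Fin m → (Fin n → ℝ) → 𝕜} (hf : ∀ i, MemLp (f i) (ENNReal.ofReal r) volume)
    (hc : ∀ i, HasCompactSupport (f i)) (hb : ∀ i, ∃ B : ℝ, ∀ y, ‖f i y‖ ≤ B) (R : Cube n) :
    ∀ᵐ x : Fin n → ℝ, x ∈ R.toSet →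
      Integrable (fun y : Fin m → Fin n → ℝ =>
        K x y * (∏ i, f i (y i) - ∏ i, R.five.toSet.indicator (f i) (y i))) ∧
      T (fun i => (hf i).toLp (f i)) x -
        T (fun i => ((hf i).indicator R.five.measurableSet_toSet).toLp
          (R.five.toSet.indicator (f i))) x =
        ∫ y : Fin m → Fin n → ℝ,
          K x y * (∏ i, f i (y i) - ∏ i, R.five.toSet.indicator (f i) (y i)) := by
  set D := R.five.toSet
  have hD : MeasurableSet D := R.five.measurableSet_toSet
  let u : Fin m → (Fin n → ℝ) → 𝕜 := fun i => D.indicator (f i)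
  let v : Fin m → (Fin n → ℝ) → 𝕜 := fun i => Dᶜ.indicator (f i)
  have hu : ∀ i, MemLp (u i) (ENNReal.ofReal r) volume := fun i => (hf i).indicator hD
  have hv : ∀ i, MemLp (v i) (ENNReal.ofReal r) volume := fun i => (hf i).indicator hD.compl
  have hw : ∀ (s : Finset (Fin m)) i, MemLp (s.piecewise u v i) (ENNReal.ofReal r) volume := by
    intro s i
    by_cases hi : i ∈ s
    · simpa [hi] using hu i
    · simpa [hi] using hv i
  have hwle : ∀ (s : Finset (Fin m)) i y, s.piecewise u v i y = 0 ∨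
      s.piecewise u v i y = f i y := by
    intro s i y
    by_cases hi : i ∈ s <;> by_cases hy : y ∈ D <;> simp [hi, hy, u, v]
  have hwc : ∀ (s : Finset (Fin m)) i, HasCompactSupport (s.piecewise u v i) := by
    intro s i
    refine (hc i).mono fun y hy => ?_
    rcases hwle s i y with h | h
    · exact absurd h hy
    · rw [Function.mem_support, ← h]
      exact hy
  have hwb : ∀ (s : Finset (Fin m)) i, ∃ B : ℝ, ∀ y, ‖s.piecewise u v i y‖ ≤ B := by
    intro s i
    obtain ⟨B, hB⟩ := hb i
    refine ⟨B, fun y => ?_⟩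
    rcases hwle s i y with h | h
    · rw [h, norm_zero]
      exact (norm_nonneg _).trans (hB y)
    · rw [h]
      exact hB y
  -- A term with one factor cut off to `Dᶜ` has that factor's closed support away from `R`, so the
  -- kernel formula applies almost everywhere on `R`.
  have hR : Disjoint R.toSet (closure Dᶜ) := by
    rw [closure_compl, disjoint_compl_right_iff_subset]
    have hs := R.side_pos
    have hsub : (Set.univ.pi fun j =>
        Ioo (R.five.center j - R.five.side / 2) (R.five.center j + R.five.side / 2)) ⊆ D :=
      pi_mono fun j _ => Ioo_subset_Ico_self
    refine fun x hx =>
      interior_maximal hsub (isOpen_set_pi finite_univ fun _ _ => isOpen_Ioo) fun j _ => ?_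
    have := Cube.mem_toSet.1 hx j
    simp only [Cube.five, Cube.dilate]
    constructor <;> linarith
  let U : Fin m → Lp (α := Fin n → ℝ) 𝕜 (ENNReal.ofReal r) volume := fun i => (hu i).toLp (u i)
  let V : Fin m → Lp (α := Fin n → ℝ) 𝕜 (ENNReal.ofReal r) volume := fun i => (hv i).toLp (v i)
  have hUV : (fun i => (hf i).toLp (f i)) = U + V := by
    funext i
    rw [Pi.add_apply, ← MemLp.toLp_add]
    exact MemLp.toLp_congr _ _ (by simp [u, v, indicator_self_add_compl])
  have hpw : ∀ s : Finset (Fin m),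
      s.piecewise U V = fun i => (hw s i).toLp (s.piecewise u v i) := by
    intro s
    funext i
    by_cases hi : i ∈ s
    · simp [hi, U]
    · simp [hi, V]
  have hprod : ∀ y : Fin m → Fin n → ℝ, ∏ i, f i (y i) - ∏ i, u i (y i) =
      ∑ s ∈ (Finset.univ : Finset (Finset (Fin m))).erase Finset.univ,
        ∏ i, s.piecewise u v i (y i) := by
    intro y
    have h1 := (MultilinearMap.mkPiAlgebra 𝕜 (Fin m) 𝕜).map_add_univ
      (fun i => u i (y i)) (fun i => v i (y i))
    rw [← Finset.sum_erase_add _ _ (Finset.mem_univ (Finset.univ : Finset (Fin m))),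
      Finset.piecewise_univ] at h1
    simp only [MultilinearMap.mkPiAlgebra_apply, Pi.add_apply] at h1
    have h2 : ∀ i, u i (y i) + v i (y i) = f i (y i) := fun i =>
      congrFun (indicator_self_add_compl D (f i)) (y i)
    simp_rw [h2] at h1
    rw [h1, add_sub_cancel_right]
    refine Finset.sum_congr rfl fun s _ => Finset.prod_congr rfl fun i _ => ?_
    by_cases hi : i ∈ s <;> simp [hi]
  have hker : ∀ᵐ x : Fin n → ℝ, ∀ s : Finset (Fin m), _ :=
    ae_all_iff.2 fun s => hK (s.piecewise u v) (hw s) (hwc s) (hwb s)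
  have hsub := AEEqFun.coeFn_sub (T (U + V)) (T U)
  rw [map_add_sub_map] at hsub
  filter_upwards [hker, hsub, coeFn_finset_sum
    ((Finset.univ : Finset (Finset (Fin m))).erase Finset.univ)
    (fun s => T (s.piecewise U V))] with x hxker hxsub hxsum hxR
  have hxs : ∀ s ∈ (Finset.univ : Finset (Finset (Fin m))).erase Finset.univ,
      x ∉ ⋂ i, tsupport (s.piecewise u v i) := by
    intro s hs hx
    obtain ⟨j, hj⟩ := exists_notMem_of_mem_erase hs
    have hxj := mem_iInter.1 hx j
    rw [Finset.piecewise_eq_of_notMem _ _ _ hj] at hxj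
    exact Set.disjoint_left.1 hR hxR (closure_mono support_indicator_subset hxj)
  change Integrable (fun y => K x y * (∏ i, f i (y i) - ∏ i, u i (y i))) ∧
    T (fun i => (hf i).toLp (f i)) x - T U x =
      ∫ y, K x y * (∏ i, f i (y i) - ∏ i, u i (y i))
  simp_rw [hprod, Finset.mul_sum]
  refine ⟨integrable_finsetSum _ fun s hs => (hxker s (hxs s hs)).1, ?_⟩
  rw [integral_finsetSum _ fun s hs => (hxker s (hxs s hs)).1, hUV, ← Pi.sub_apply, ← hxsub,
    hxsum]
  refine Finset.sum_congr rfl fun s hs => ?_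
  rw [hpw s]
  exact (hxker s (hxs s hs)).2

/-- The truncation of a scalar at height `N`. -/
def truncate (N : ℕ) (z : 𝕜) : 𝕜 := if ‖z‖ ≤ N then z else 0

lemma measurable_truncate (N : ℕ) : Measurable (truncate N : 𝕜 → 𝕜) :=
  Measurable.ite (measurableSet_le measurable_norm measurable_const) measurable_id measurable_const

lemma norm_truncate_le (N : ℕ) (z : 𝕜) : ‖truncate N z‖ ≤ ‖z‖ := by
  unfold truncate
  split_ifs <;> simp

lemma norm_truncate_le' (N : ℕ) (z : 𝕜) : ‖truncate N z‖ ≤ N := by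
  unfold truncate
  split_ifs with h
  · exact h
  · simp

lemma enorm_truncate_sub_le (N : ℕ) (z : 𝕜) : ‖truncate N z - z‖ₑ ≤ ‖z‖ₑ := by
  unfold truncate
  split_ifs <;> simp

lemma memLp_truncate {f : (Fin n → ℝ) → 𝕜} {p : ℝ≥0∞} (hf : MemLp f p volume) (N : ℕ) :
    MemLp (fun y => truncate N (f y)) p volume :=
  hf.mono ((measurable_truncate N).comp_aemeasurable
    hf.aestronglyMeasurable.aemeasurable).aestronglyMeasurable
    (Eventually.of_forall fun _ => norm_truncate_le N _)

/-- Dominated convergence. The kernel formula is assumed for bounded functions only, so general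
`f_i` are reached through truncations. -/
lemma tendsto_eLpNorm_truncate_sub (hr : 1 ≤ r) {f : (Fin n → ℝ) → 𝕜}
    (hf : MemLp f (ENNReal.ofReal r) volume) :
    Tendsto (fun N : ℕ => eLpNorm (fun y => truncate N (f y) - f y) (ENNReal.ofReal r) volume)
      atTop (𝓝 0) := by
  have hr0 : 0 < r := by linarith
  simp_rw [eLpNorm_eq_lintegral_enorm hr]
  have hfin : ∫⁻ y, ‖f y‖ₑ ^ r ≠ ∞ := by
    have := hf.eLpNorm_ne_top
    rw [eLpNorm_eq_lintegral_enorm hr] at this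
    intro h
    rw [h, ENNReal.top_rpow_of_pos (by positivity)] at this
    exact this rfl
  have hlim : Tendsto (fun N : ℕ => ∫⁻ y, ‖truncate N (f y) - f y‖ₑ ^ r) atTop
      (𝓝 (∫⁻ _ : Fin n → ℝ, 0)) := by
    refine tendsto_lintegral_of_dominated_convergence' (fun y => ‖f y‖ₑ ^ r) (fun N => ?_)
      (fun N => Eventually.of_forall fun y => ?_) hfin (Eventually.of_forall fun y => ?_)
    · exact ((memLp_truncate hf N).aestronglyMeasurable.sub
        hf.aestronglyMeasurable).enorm.pow_const r
    · exact ENNReal.rpow_le_rpow (enorm_truncate_sub_le N _) hr0.le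
    · obtain ⟨N₀, hN₀⟩ := exists_nat_ge ‖f y‖
      refine tendsto_const_nhds.congr' ?_
      filter_upwards [eventually_ge_atTop N₀] with N hN
      have : ‖f y‖ ≤ N := hN₀.trans (by exact_mod_cast hN)
      simp [truncate, this, hr0]
  rw [lintegral_zero] at hlim
  have h2 := (ENNReal.continuous_rpow_const (y := 1 / r)).tendsto 0
  rw [ENNReal.zero_rpow_of_pos (by positivity)] at h2
  exact h2.comp hlim

/-- The oscillation of `T(f) - T(f χ_{5R})` in the cube `R` is controlled by the Hörmander
constant. -/
theorem ae_ae_enorm_sub_indicator_sub_le (hr : 1 ≤ r) (hm : 1 ≤ m)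
    {T : MultilinearOperator 𝕜 n m r} {K : (Fin n → ℝ) → (Fin m → Fin n → ℝ) → 𝕜}
    (hK : HasKernel T K) (hT : opNorm T < ∞)
    {f : Fin m → (Fin n → ℝ) → 𝕜} (hf : ∀ i, MemLp (f i) (ENNReal.ofReal r) volume)
    (hc : ∀ i, HasCompactSupport (f i)) (R : Cube n) {g : (Fin n → ℝ) → 𝕜}
    (hg : ∀ x, g x = T (fun i => (hf i).toLp (f i)) x -
        T (fun i => ((hf i).indicator R.five.measurableSet_toSet).toLp
          (R.five.toSet.indicator (f i))) x) {M : ℝ≥0∞}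
    (hM : ∀ k : ℕ, ∏ i, (∫⁻ y in ((R.dilate 2 (by norm_num)).twoPow (k + 1)).toSet,
        ‖f i y‖ₑ ^ r) ^ (1 / r) ≤
      volume ((R.dilate 2 (by norm_num)).twoPow (k + 1)).toSet ^ ((m : ℝ) / r) * M) :
    ∀ᵐ x : Fin n → ℝ, x ∈ R.toSet → ∀ᵐ z : Fin n → ℝ, z ∈ R.toSet →
      ‖g x - g z‖ₑ ≤ hormanderConst r K * M := by
  set D := R.five.toSet
  have hD : MeasurableSet D := R.five.measurableSet_toSet
  let φ : ℕ → Fin m → (Fin n → ℝ) → 𝕜 := fun N i y => truncate N (f i y)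
  have hφ : ∀ N i, MemLp (φ N i) (ENNReal.ofReal r) volume := fun N i => memLp_truncate (hf i) N
  have hφsupp : ∀ N i, HasCompactSupport (φ N i) := fun N i =>
    (hc i).comp_left (g := truncate N) (by simp [truncate])
  have h1 := tendstoInMeasure_apply hr hm hT hf hφ
    fun i => tendsto_eLpNorm_truncate_sub hr (hf i)
  have h2 := tendstoInMeasure_apply hr hm hT (fun i => (hf i).indicator hD)
    (fun N i => (hφ N i).indicator hD) fun i => by
      refine tendsto_of_tendsto_of_tendsto_of_le_of_le tendsto_const_nhds
        (tendsto_eLpNorm_truncate_sub hr (hf i)) (fun _ => zero_le) fun N => ?_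
      rw [← indicator_sub']
      exact eLpNorm_indicator_le _
  -- Convergence in measure gives almost everywhere convergence along a subsequence; the second is
  -- extracted from the first, so that both terms converge along it.
  obtain ⟨a, ha, ha_lim⟩ := h1.exists_seq_tendsto_ae
  obtain ⟨b, hb, hb_lim⟩ := (h2.comp ha.tendsto_atTop).exists_seq_tendsto_ae
  have hrep := ae_all_iff.2 fun N => ae_sub_indicator_eq_integral hK (hφ N) (hφsupp N)
    (fun i => ⟨N, fun y => norm_truncate_le' N _⟩) R
  let G : ℕ → (Fin n → ℝ) → 𝕜 := fun k w =>
    T (fun i => (hφ (a (b k)) i).toLp (φ (a (b k)) i)) w -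
      T (fun i => ((hφ (a (b k)) i).indicator hD).toLp (D.indicator (φ (a (b k)) i))) w
  have hG : ∀ᵐ w, Tendsto (fun k => G k w) atTop (𝓝 (g w)) := by
    filter_upwards [ha_lim, hb_lim] with w hw1 hw2
    rw [hg]
    exact (hw1.comp hb.tendsto_atTop).sub hw2
  filter_upwards [hG.and hrep] with x hx hxR
  filter_upwards [hG.and hrep] with z hz hzR
  refine le_of_tendsto ((continuous_enorm.tendsto _).comp (hx.1.sub hz.1))
    (Eventually.of_forall fun k => ?_)
  obtain ⟨hix, hex⟩ := hx.2 (a (b k)) hxR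
  obtain ⟨hiz, hez⟩ := hz.2 (a (b k)) hzR
  simp only [Function.comp, G]
  rw [hex, hez]
  -- The Hörmander condition is used for the cube `2R`: its half is `R`, and the difference of the
  -- two products vanishes on `(2R)^m` because `2R ⊆ 5R`.
  have hhalf : (R.dilate 2 (by norm_num)).half = R := by
    ext <;> simp [Cube.half, Cube.dilate]
  have hRD : (R.dilate 2 (by norm_num)).toSet ⊆ D := by
    intro y hy
    rw [Cube.mem_toSet] at hy
    refine Cube.mem_toSet.2 fun l => ?_
    have := hy l
    have hs := R.side_pos
    simp only [Cube.dilate, Cube.five] at this ⊢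
    constructor <;> linarith
  have hmeas : ∀ {ψ : Fin m → (Fin n → ℝ) → 𝕜}, (∀ i, AEStronglyMeasurable (ψ i) volume) →
      AEStronglyMeasurable (fun y : Fin m → Fin n → ℝ => ∏ i, ψ i (y i)) volume := fun hψ =>
    Finset.aestronglyMeasurable_fun_prod _ fun i _ =>
      (hψ i).comp_quasiMeasurePreserving (Measure.quasiMeasurePreserving_eval _ i)
  refine enorm_integral_sub_le hr K (R.dilate 2 (by norm_num)) (by rwa [hhalf]) (by rwa [hhalf])
    ?_ (fun y hy => ?_) (fun i => (hf i).aestronglyMeasurable) (fun y => ?_) hix hiz hM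
  · exact (hmeas fun i => (hφ _ i).aestronglyMeasurable).sub
      (hmeas fun i => ((hφ _ i).indicator hD).aestronglyMeasurable)
  · rw [sub_eq_zero]
    refine Finset.prod_congr rfl fun i _ => ?_
    rw [indicator_of_mem (hRD (hy i (mem_univ i)))]
  · by_cases hy : ∀ i, y i ∈ D
    · rw [Finset.prod_congr rfl fun i _ => indicator_of_mem (hy i) _, sub_self, enorm_zero]
      exact zero_le
    · push Not at hy
      obtain ⟨j, hj⟩ := hy
      rw [Finset.prod_eq_zero (f := fun i => D.indicator (φ (a (b k)) i) (y i))
        (Finset.mem_univ j) (indicator_of_notMem hj _), sub_zero, enorm_eq_nnnorm, nnnorm_prod, ENNReal.ofNNReal_finsetProd]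
      exact Finset.prod_le_prod' fun i _ => enorm_le_iff_norm_le.2 (norm_truncate_le _ _)

/-! ### Maximal stopping cubes -/

namespace Dyadic

variable {n : ℕ} {p : Dyadic n → Prop} {Q R : Dyadic n}

/-- The maximal dyadic subcubes of `Q` with the property `p`. -/
def maximal (p : Dyadic n → Prop) (Q : Dyadic n) : Set (Dyadic n) :=
  {R | ∃ x ∈ Q.cube.toSet, ∃ i : ℕ, R = containing (Q.1 - i) x ∧ p R ∧
    ∀ i' < i, ¬ p (containing (Q.1 - (i' : ℕ)) x)}

lemma of_mem_maximal (h : R ∈ maximal p Q) : p R := by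
  obtain ⟨-, -, -, -, h, -⟩ := h
  exact h

lemma le_of_mem_maximal (h : R ∈ maximal p Q) : R.1 ≤ Q.1 := by
  obtain ⟨x, -, i, rfl, -⟩ := h
  simp [containing]

lemma subset_of_mem_maximal (h : R ∈ maximal p Q) : R.cube.toSet ⊆ Q.cube.toSet := by
  obtain ⟨x, hx, i, rfl, -⟩ := h
  conv_rhs => rw [← mem_cube_iff.1 hx]
  exact containing_subset (by omega) x

lemma pairwiseDisjoint_maximal (p : Dyadic n → Prop) (Q : Dyadic n) :
    (maximal p Q).PairwiseDisjoint fun R => R.cube.toSet := by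
  have aux : ∀ {x x' z : Fin n → ℝ} {i i' : ℕ}, z ∈ (containing (Q.1 - i) x).cube.toSet →
      z ∈ (containing (Q.1 - i') x').cube.toSet → p (containing (Q.1 - i) x) →
      (∀ j < i', ¬ p (containing (Q.1 - (j : ℕ)) x')) → ¬ i < i' := by
    intro x x' z i i' hz hz' hp hp' hi
    rw [mem_containing_iff] at hz hz'
    refine hp' i hi ?_
    rwa [← containing_of_le (by omega) hz', hz]
  rintro R ⟨x, hx, i, rfl, hp, hmax⟩ R' ⟨x', hx', i', rfl, hp', hmax'⟩ hne
  refine Set.disjoint_left.2 fun z hz hz' => hne ?_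
  have h1 := aux hz hz' hp hmax'
  have h2 := aux hz' hz hp' hmax
  obtain rfl : i = i' := by omega
  rw [← mem_containing_iff.1 hz, ← mem_containing_iff.1 hz']

lemma mem_union_maximal {x : Fin n → ℝ} (hx : x ∈ Q.cube.toSet) {i : ℕ}
    (hi : p (containing (Q.1 - i) x)) : x ∈ union (maximal p Q) := by
  classical
  have hex : ∃ i : ℕ, p (containing (Q.1 - i) x) := ⟨i, hi⟩
  exact mem_union.2 ⟨_, ⟨x, hx, Nat.find hex, rfl, Nat.find_spec hex,
    fun i' hi' => Nat.find_min hex hi'⟩, mem_containing _ x⟩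

lemma not_of_mem_maximal (h : R ∈ maximal p Q) {x : Fin n → ℝ} (hx : x ∈ R.cube.toSet) {k : ℤ}
    (hk : R.1 < k) (hkQ : k ≤ Q.1) : ¬ p (containing k x) := by
  obtain ⟨y, -, i, rfl, -, hmax⟩ := h
  obtain ⟨j, rfl⟩ : ∃ j : ℕ, k = Q.1 - j := ⟨(Q.1 - k).toNat, by omega⟩
  rw [mem_containing_iff] at hx
  simp only [containing] at hk
  rw [containing_of_le (by omega) hx]
  exact hmax j (by omega)

lemma volume_containing_add (d : Dyadic n) (x : Fin n → ℝ) (k : ℕ) :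
    volume (containing (d.1 + k) x).cube.toSet = (2 ^ k) ^ n * volume d.cube.toSet := by
  have h2 : (2 : ℝ≥0∞) ^ k = ENNReal.ofReal (2 ^ k) := by
    rw [ENNReal.ofReal_pow (by norm_num)]
    simp
  rw [Cube.volume_toSet, Cube.volume_toSet, ← mul_pow, h2, ← ENNReal.ofReal_mul (by positivity)]
  congr 2
  simp only [cube, containing]
  rw [zpow_add₀ (by norm_num), zpow_natCast, mul_comm]

/-- The `k`-th ancestor contains the cube and has side `2^k ℓ`; its fivefold dilate reaches `2 · 2^k
ℓ` further on each side, more than `2^{k+1} d` needs. -/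
lemma dilate_subset_five {d : Dyadic n} {x : Fin n → ℝ} (hx : x ∈ d.cube.toSet) (k : ℕ) :
    (d.cube.dilate (2 ^ (k + 1)) (by positivity)).toSet ⊆
      (containing (d.1 + k) x).cube.five.toSet := by
  intro y hy
  rw [Cube.mem_toSet] at hx hy ⊢
  have hx' := Cube.mem_toSet.1 (mem_containing (d.1 + k) x)
  intro l
  have h1 := hx l
  have h2 := hx' l
  have h3 := hy l
  have hside : (containing (d.1 + k) x).cube.side = 2 ^ k * d.cube.side := by
    simp only [cube, containing]
    rw [zpow_add₀ (by norm_num), zpow_natCast, mul_comm]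
  have hs : d.cube.side ≤ 2 ^ k * d.cube.side :=
    le_mul_of_one_le_left d.cube.side_pos.le (one_le_pow₀ (by norm_num))
  have hs0 := d.cube.side_pos
  simp only [Cube.five, Cube.dilate, hside, pow_succ] at *
  constructor <;> linarith

/-- Either the `k`-th ancestor is still within `Q` and, by maximality, did not stop (whence `1 ≤
k`), or it is larger than `Q` and the bound on the total mass suffices. -/
lemma lintegral_dilate_le (hR : R ∈ maximal p Q) {G : (Fin n → ℝ) → ℝ≥0∞} {b : ℝ≥0∞}
    (hp : ∀ S : Dyadic n, ¬ p S → ∫⁻ y in S.cube.five.toSet, G y ≤ b * volume S.cube.toSet)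
    (hQ : ∫⁻ y, G y ≤ b * volume Q.cube.toSet) {k : ℕ} (hk : 1 ≤ k) :
    ∫⁻ y in (R.cube.dilate (2 ^ (k + 1)) (by positivity)).toSet, G y ≤
      b * ((2 ^ k) ^ n * volume R.cube.toSet) := by
  obtain ⟨x, hx⟩ := R.cube_nonempty
  by_cases hkQ : R.1 + k ≤ Q.1
  · rw [← volume_containing_add R x k]
    exact (lintegral_mono_set (dilate_subset_five hx k)).trans
      (hp _ (not_of_mem_maximal hR hx (by omega) hkQ))
  · refine (setLIntegral_le_lintegral _ _).trans (hQ.trans ?_)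
    gcongr
    rw [← volume_containing_add R x k, Cube.volume_toSet, Cube.volume_toSet]
    gcongr
    exact zpow_le_zpow_right₀ (by norm_num) (show Q.1 ≤ R.1 + k by omega)

lemma mul_volume_union_le {t : Set (Dyadic n)} {K : ℤ} (ht : ∀ R ∈ t, R.1 ≤ K)
    (g : (Fin n → ℝ) → ℝ≥0∞) (c : ℝ≥0∞)
    (h : ∀ R ∈ t, c * volume R.cube.toSet ≤ ∫⁻ y in R.cube.five.toSet, g y) :
    c * volume (union t) ≤ 25 ^ n * ∫⁻ y, g y :=
  Cube.mul_volume_biUnion_le t.to_countable cube (2 ^ K)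
    (fun R hR => zpow_le_zpow_right₀ (by norm_num) (ht R hR)) g c h

/-- The stopping condition: the set `E` has large density in `R`, or one of the functions `g i`
has a large average over `5R`. -/
def Stopping {m : ℕ} (E : Set (Fin n → ℝ)) (b : Fin m → ℝ≥0∞) (g : Fin m → (Fin n → ℝ) → ℝ≥0∞)
    (R : Dyadic n) : Prop :=
  (2 ^ (n + 1))⁻¹ * volume R.cube.toSet < volume (R.cube.toSet ∩ E) ∨
    ∃ i, b i * volume R.cube.toSet < ∫⁻ y in R.cube.five.toSet, g i y

/-- By the Vitali bound, cubes stopped by the density of `E` cover at most a quarter of `Q`, and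
those stopped by a given `g i` at most `1 / (4m)` of it. Here `125 ^ n` is `25 ^ n` from Vitali
times `5 ^ n` from `|5Q|`. -/
lemma two_mul_volume_union_maximal_le {m : ℕ} (hm : 1 ≤ m) {E : Set (Fin n → ℝ)}
    (hE : MeasurableSet E) (hEQ : 4 * 25 ^ n * 2 ^ (n + 1) * volume E ≤ volume Q.cube.toSet)
    {a : Fin m → ℝ≥0∞} (ha : ∀ i, a i ≠ ∞) {g : Fin m → (Fin n → ℝ) → ℝ≥0∞}
    (hg : ∀ i, ∫⁻ y, g i y = 5 ^ n * volume Q.cube.toSet * a i) :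
    2 * volume (union (maximal (Stopping E (fun i => 4 * m * 125 ^ n * a i) g) Q)) ≤
      volume Q.cube.toSet := by
  let t : Set (Dyadic n) := {R | R.1 ≤ Q.1 ∧
    (2 ^ (n + 1))⁻¹ * volume R.cube.toSet < volume (R.cube.toSet ∩ E)}
  let u : Fin m → Set (Dyadic n) := fun i => {R | R.1 ≤ Q.1 ∧
    4 * m * 125 ^ n * a i * volume R.cube.toSet < ∫⁻ y in R.cube.five.toSet, g i y}
  have hcov : union (maximal (Stopping E (fun i => 4 * m * 125 ^ n * a i) g) Q) ⊆
      union t ∪ ⋃ i, union (u i) := by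
    intro x hx
    obtain ⟨R, hR, hxR⟩ := mem_union.1 hx
    have hle := le_of_mem_maximal hR
    rcases of_mem_maximal hR with h | ⟨i, h⟩
    · exact Or.inl (mem_union.2 ⟨R, ⟨hle, h⟩, hxR⟩)
    · exact Or.inr (mem_iUnion.2 ⟨i, mem_union.2 ⟨R, ⟨hle, h⟩, hxR⟩⟩)
  have hm0 : (m : ℝ≥0∞) ≠ 0 := by simpa using (by omega : m ≠ 0)
  have htvol : 4 * volume (union t) ≤ volume Q.cube.toSet := by
    have h := mul_volume_union_le (t := t) (fun R hR => hR.1) (E.indicator 1) (2 ^ (n + 1))⁻¹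
      fun R hR => by
        rw [lintegral_indicator_one hE, Measure.restrict_apply hE, inter_comm]
        exact hR.2.le.trans (measure_mono (inter_subset_inter_left _ R.cube.toSet_subset_five))
    rw [lintegral_indicator_one hE] at h
    calc 4 * volume (union t)
        = 4 * 2 ^ (n + 1) * ((2 ^ (n + 1))⁻¹ * volume (union t)) := by
          rw [mul_assoc 4, ← mul_assoc (2 ^ (n + 1)), ENNReal.mul_inv_cancel (by simp) (by simp),
            one_mul]
      _ ≤ 4 * 2 ^ (n + 1) * (25 ^ n * volume E) := by gcongr
      _ = 4 * 25 ^ n * 2 ^ (n + 1) * volume E := by ring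
      _ ≤ volume Q.cube.toSet := hEQ
  have huvol : ∀ i, m * (4 * volume (union (u i))) ≤ volume Q.cube.toSet := by
    intro i
    -- A zero threshold cannot be divided out, but then `g i` has integral 0 and stops no cube.
    by_cases hai : a i = 0
    · have : u i = ∅ := by
        refine eq_empty_of_forall_notMem fun R hR => ?_
        have h1 := hR.2.trans_le (setLIntegral_le_lintegral _ _)
        rw [hg, hai] at h1
        simp at h1
      simp [this, union]
    · have h := mul_volume_union_le (t := u i) (fun R hR => hR.1) (g i) (4 * m * 125 ^ n * a i)
        fun R hR => hR.2.le
      rw [hg] at h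
      have e1 : 4 * m * 125 ^ n * a i * volume (union (u i)) =
          (125 ^ n * a i) * (m * (4 * volume (union (u i)))) := by ring
      have e2 : 25 ^ n * (5 ^ n * volume Q.cube.toSet * a i) =
          (125 ^ n * a i) * volume Q.cube.toSet := by
        rw [show (125 : ℝ≥0∞) = 25 * 5 by norm_num, mul_pow]
        ring
      rw [e1, e2] at h
      exact (ENNReal.mul_le_mul_iff_right (mul_ne_zero (by simp) hai)
        (ENNReal.mul_ne_top (by simp) (ha i))).1 h
  have hsum : 4 * volume (⋃ i, union (u i)) ≤ volume Q.cube.toSet := by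
    refine (ENNReal.mul_le_mul_iff_right hm0 (ENNReal.natCast_ne_top m)).1 ?_
    calc m * (4 * volume (⋃ i, union (u i))) ≤ m * (4 * ∑ i, volume (union (u i))) := by
          gcongr
          exact measure_iUnion_fintype_le _ _
      _ = ∑ i, m * (4 * volume (union (u i))) := by rw [Finset.mul_sum, Finset.mul_sum]
      _ ≤ ∑ _i : Fin m, volume Q.cube.toSet := Finset.sum_le_sum fun i _ => huvol i
      _ = m * volume Q.cube.toSet := by simp
  refine (ENNReal.mul_le_mul_iff_right (a := 2) (by simp) (by simp)).1 ?_
  calc 2 * (2 * volume (union (maximal (Stopping E (fun i => 4 * m * 125 ^ n * a i) g) Q)))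
      ≤ 2 * (2 * (volume (union t) + volume (⋃ i, union (u i)))) := by
        gcongr
        exact (measure_mono hcov).trans (measure_union_le _ _)
    _ = 4 * volume (union t) + 4 * volume (⋃ i, union (u i)) := by ring
    _ ≤ volume Q.cube.toSet + volume Q.cube.toSet := add_le_add htvol hsum
    _ = 2 * volume Q.cube.toSet := (two_mul _).symm

end Dyadic

/-- The size of `T(f₁ χ_{5Q}, …, f_m χ_{5Q})`. -/
def localize (T : MultilinearOperator 𝕜 n m r) {f : Fin m → (Fin n → ℝ) → 𝕜}
    (hf : ∀ i, MemLp (f i) (ENNReal.ofReal r) volume) (Q : Cube n) (x : Fin n → ℝ) : ℝ≥0∞ :=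
  ‖T (fun i => ((hf i).indicator Q.five.measurableSet_toSet).toLp (Q.five.toSet.indicator (f i)))
    x‖ₑ

lemma measurable_localize (T : MultilinearOperator 𝕜 n m r) {f : Fin m → (Fin n → ℝ) → 𝕜}
    (hf : ∀ i, MemLp (f i) (ENNReal.ofReal r) volume) (Q : Cube n) :
    Measurable (localize T hf Q) :=
  (AEEqFun.stronglyMeasurable _).enorm

lemma prod_mul_rpow (hr : 1 ≤ r) (c : ℝ≥0∞) (a : Fin m → ℝ≥0∞) :
    ∏ i, (c * a i) ^ (1 / r) = c ^ ((m : ℝ) / r) * ∏ i, a i ^ (1 / r) := by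
  have hr0 : 0 ≤ 1 / r := by positivity
  simp_rw [ENNReal.mul_rpow_of_nonneg _ _ hr0]
  rw [Finset.prod_mul_distrib, Finset.prod_const, Finset.card_fin, ← ENNReal.rpow_natCast,
    ← ENNReal.rpow_mul]
  congr 2
  ring

/-- The weak type bound for `T(f₁ χ_{5Q}, …, f_m χ_{5Q})`. -/
theorem mul_volume_lt_localize_le (hr : 1 ≤ r) (hm : 1 ≤ m) {T : MultilinearOperator 𝕜 n m r}
    (hT : opNorm T < ∞) {f : Fin m → (Fin n → ℝ) → 𝕜}
    (hf : ∀ i, MemLp (f i) (ENNReal.ofReal r) volume) (Q : Cube n) {a : Fin m → ℝ≥0∞}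
    (ha : ∀ i, a i ≠ ∞) {V : ℝ≥0∞}
    (h : ∀ i, ∫⁻ y in Q.five.toSet, ‖f i y‖ₑ ^ r ≤ V * a i) {σ : ℝ≥0} (hσ : σ ≠ 0) :
    σ * volume {x | (σ ^ ((m : ℝ) / r) : ℝ≥0) * (opNorm T * ∏ i, a i ^ (1 / r)) <
      localize T hf Q x} ≤ V := by
  have hr0 : 0 < r := by linarith
  have hm0 : 0 < (m : ℝ) := by exact_mod_cast hm
  have hB : opNorm T * ∏ i, a i ^ (1 / r) ≠ ∞ :=
    ENNReal.mul_ne_top hT.ne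
      (ENNReal.prod_ne_top fun i _ => ENNReal.rpow_ne_top_of_nonneg (by positivity) (ha i))
  have hp : 0 < r / m := by positivity
  have hW := volume_lt_enorm_le_of_weakNorm_le hp (V := V) hB (g := ⇑(T fun i =>
    ((hf i).indicator Q.five.measurableSet_toSet).toLp (Q.five.toSet.indicator (f i)))) ?_
    (s := σ ^ ((m : ℝ) / r)) (by simpa [NNReal.rpow_eq_zero_iff] using fun h => absurd h hσ)
  · have hs : ((σ ^ ((m : ℝ) / r) : ℝ≥0) : ℝ≥0∞) ^ (r / m) = σ := by
      rw [← ENNReal.coe_rpow_of_nonneg _ (by positivity), ← NNReal.rpow_mul]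
      field_simp
      simp
    rw [hs] at hW
    exact (mul_le_mul_right hW _).trans ENNReal.mul_div_le
  · refine (weakNorm_apply_le hT _).trans ?_
    rw [one_div_div, mul_assoc, mul_comm (∏ i, a i ^ (1 / r)), ← prod_mul_rpow hr]
    gcongr with i
    rw [eLpNorm_congr_ae (MemLp.coeFn_toLp _),
      eLpNorm_indicator_eq_eLpNorm_restrict Q.five.measurableSet_toSet,
      eLpNorm_eq_lintegral_enorm hr]
    gcongr
    exact h i

lemma Cube.five_subset_five {P Q : Cube n} (h : P.toSet ⊆ Q.toSet) :
    P.five.toSet ⊆ Q.five.toSet := by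
  have hP := P.side_pos
  have h' : ∀ j, Ico (P.center j - P.side / 2) (P.center j + P.side / 2) ⊆
      Ico (Q.center j - Q.side / 2) (Q.center j + Q.side / 2) := by
    rcases univ_pi_subset_univ_pi_iff.1 h with h | ⟨i, hi⟩
    · exact h
    · rw [Ico_eq_empty_iff] at hi
      exact absurd (by linarith) hi
  refine pi_mono fun j _ => ?_
  have := (Ico_subset_Ico_iff (by linarith)).1 (h' j)
  simp only [Cube.five, Cube.dilate]
  exact Ico_subset_Ico (by linarith) (by linarith)

/-- The product of the `L^r` averages of the functions `f i` over `Q`. -/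
def averageProd (r : ℝ) (f : Fin m → (Fin n → ℝ) → 𝕜) (Q : Cube n) : ℝ≥0∞ :=
  ∏ i, ((volume Q.toSet)⁻¹ * ∫⁻ y in Q.toSet, ‖f i y‖ₑ ^ r) ^ (1 / r)

/-- The constant in the sparse domination theorem, up to its exponent. -/
def sparseConst (n m : ℕ) : ℝ≥0 := 4 * m * 125 ^ n * (4 * 25 ^ n * 2 ^ (n + 1))

lemma sparseConst_ne_zero (n : ℕ) (hm : 1 ≤ m) : sparseConst n m ≠ 0 := by
  have : m ≠ 0 := by omega
  simp [sparseConst, this]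

/-- The local sparse domination estimate. -/
theorem exists_children (hr : 1 ≤ r) (hm : 1 ≤ m) {T : MultilinearOperator 𝕜 n m r}
    {K : (Fin n → ℝ) → (Fin m → Fin n → ℝ) → 𝕜} (hK : HasKernel T K) (hT : opNorm T < ∞)
    {f : Fin m → (Fin n → ℝ) → 𝕜} (hf : ∀ i, MemLp (f i) (ENNReal.ofReal r) volume)
    (hc : ∀ i, HasCompactSupport (f i)) (Q : Dyadic n) {A : ℝ≥0∞}
    (hA : A = (2 * sparseConst n m ^ ((m : ℝ) / r) : ℝ≥0) * (opNorm T + hormanderConst r K) *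
      averageProd r f Q.cube.five) :
    ∃ ch : Set (Dyadic n), (∀ R ∈ ch, R.cube.toSet ⊆ Q.cube.toSet) ∧
      (ch.PairwiseDisjoint fun R => R.cube.toSet) ∧
      2 * volume (Dyadic.union ch) ≤ volume Q.cube.toSet ∧
      (∀ᵐ x : Fin n → ℝ, ∀ R ∈ ch, x ∈ R.cube.toSet →
        localize T hf Q.cube x ≤ A + localize T hf R.cube x) ∧
      ∀ᵐ x : Fin n → ℝ, x ∈ Q.cube.toSet \ Dyadic.union ch → localize T hf Q.cube x ≤ A := by
  have hr0 : 0 < r := by linarith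
  have hmr : 0 ≤ (m : ℝ) / r := by positivity
  have hm0 : m ≠ 0 := by omega
  set D := Q.cube.five.toSet
  have hD : MeasurableSet D := Q.cube.five.measurableSet_toSet
  let F : Fin m → (Fin n → ℝ) → 𝕜 := fun i => D.indicator (f i)
  have hF : ∀ i, MemLp (F i) (ENNReal.ofReal r) volume := fun i => (hf i).indicator hD
  have hFc : ∀ i, HasCompactSupport (F i) := fun i =>
    (hc i).mono (by rw [support_indicator]; exact inter_subset_right)
  let g : Fin m → (Fin n → ℝ) → ℝ≥0∞ := fun i y => ‖F i y‖ₑ ^ r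
  have hg : ∀ i, g i = D.indicator fun y => ‖f i y‖ₑ ^ r := by
    intro i
    funext y
    by_cases hy : y ∈ D <;> simp [g, F, hy, hr0]
  let a : Fin m → ℝ≥0∞ := fun i => (volume D)⁻¹ * ∫⁻ y in D, ‖f i y‖ₑ ^ r
  have hD0 : volume D ≠ 0 := Q.cube.five.volume_toSet_ne_zero
  have hDtop : volume D ≠ ∞ := Q.cube.five.volume_toSet_ne_top
  have hDvol : volume D = 5 ^ n * volume Q.cube.toSet := Q.cube.volume_five
  have hint : ∀ i, ∫⁻ y in D, ‖f i y‖ₑ ^ r = volume D * a i := by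
    intro i
    simp only [a]
    rw [← mul_assoc, ENNReal.mul_inv_cancel hD0 hDtop, one_mul]
  have ha : ∀ i, a i ≠ ∞ := by
    intro i
    refine ENNReal.mul_ne_top (ENNReal.inv_ne_top.2 hD0) fun h => ?_
    have h1 := (hF i).eLpNorm_ne_top
    rw [eLpNorm_indicator_eq_eLpNorm_restrict hD, eLpNorm_eq_lintegral_enorm hr, h,
      ENNReal.top_rpow_of_pos (by positivity)] at h1
    exact h1 rfl
  have hgint : ∀ i, ∫⁻ y, g i y = 5 ^ n * volume Q.cube.toSet * a i := by
    intro i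
    rw [hg, lintegral_indicator hD, hint, hDvol]
  set P := ∏ i, a i ^ (1 / r) with hP
  have hPavg : averageProd r f Q.cube.five = P := rfl
  -- The factor `4 m 125^n` of `σ` absorbs `|5Q| = 5^n |Q|` and the growth of averages allowed
  -- before stopping; the factor `4 · 25^n · 2^{n+1}` is the smallness of `E` required by `hEQ`.
  set σ := sparseConst n m with hσ
  have hσ0 : σ ≠ 0 := sparseConst_ne_zero n hm
  set s : ℝ≥0 := σ ^ ((m : ℝ) / r) with hs
  have hσcoe : (σ : ℝ≥0∞) = 4 * m * 125 ^ n * (4 * 25 ^ n * 2 ^ (n + 1)) := by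
    rw [hσ, sparseConst]
    push_cast
    rfl
  set E : Set (Fin n → ℝ) := {x | s * (opNorm T * P) < localize T hf Q.cube x}
  have hE : MeasurableSet E := measurableSet_lt measurable_const (measurable_localize T hf _)
  have hm1 : (1 : ℝ≥0∞) ≤ m := by exact_mod_cast hm
  have h5 : (5 : ℝ≥0∞) ^ n ≤ 4 * m * 125 ^ n :=
    calc (5 : ℝ≥0∞) ^ n ≤ 1 * 1 * 125 ^ n := by
          rw [one_mul, one_mul]
          gcongr
          norm_num
      _ ≤ 4 * m * 125 ^ n := by
          gcongr
          norm_num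
  have hlam0 : (4 * m * 125 ^ n : ℝ≥0∞) ≠ 0 := by simp [hm0]
  have hlamtop : (4 * m * 125 ^ n : ℝ≥0∞) ≠ ∞ :=
    ENNReal.mul_ne_top (ENNReal.mul_ne_top (by simp) (by simp)) (by simp)
  have hEQ : 4 * 25 ^ n * 2 ^ (n + 1) * volume E ≤ volume Q.cube.toSet := by
    have h := mul_volume_lt_localize_le hr hm hT hf Q.cube ha (V := volume D)
      (fun i => (hint i).le) hσ0
    refine (ENNReal.mul_le_mul_iff_right hlam0 hlamtop).1 ?_
    rw [← mul_assoc, ← hσcoe]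
    refine h.trans ?_
    rw [hDvol]
    gcongr
  set b : Fin m → ℝ≥0∞ := fun i => 4 * m * 125 ^ n * a i with hb
  set ch := Dyadic.maximal (Dyadic.Stopping E b g) Q
  have hnot : ∀ S : Dyadic n, ¬ Dyadic.Stopping E b g S →
      volume (S.cube.toSet ∩ E) ≤ (2 ^ (n + 1))⁻¹ * volume S.cube.toSet ∧
      ∀ i, ∫⁻ y in S.cube.five.toSet, g i y ≤ b i * volume S.cube.toSet := by
    intro S hS
    rw [Dyadic.Stopping, not_or, not_exists] at hS
    exact ⟨not_lt.1 hS.1, fun i => not_lt.1 (hS.2 i)⟩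
  have hgQ : ∀ i, ∫⁻ y, g i y ≤ b i * volume Q.cube.toSet := by
    intro i
    rw [hgint, hb]
    calc 5 ^ n * volume Q.cube.toSet * a i ≤ 4 * m * 125 ^ n * volume Q.cube.toSet * a i := by
          gcongr
      _ = _ := by ring
  have hdil : ∀ R ∈ ch, ∀ (i : Fin m) (k : ℕ), 1 ≤ k →
      ∫⁻ y in (R.cube.dilate (2 ^ (k + 1)) (by positivity)).toSet, g i y ≤
        b i * ((2 ^ k) ^ n * volume R.cube.toSet) := fun R hR i k hk =>
    Dyadic.lintegral_dilate_le hR (fun S hS => (hnot S hS).2 i) (hgQ i) hk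
  -- The parent of `R` did not stop, so `E` has density at most `2^{-(n+1)}` there, hence at most
  -- `1/2` in `R`, which is `2^n` times smaller. If the parent exceeds `Q`, the bound on `|E|`
  -- replaces this.
  have hRE : ∀ R ∈ ch, 2 * volume (R.cube.toSet ∩ E) ≤ volume R.cube.toSet := by
    intro R hR
    have key : volume (R.cube.toSet ∩ E) ≤
        (2 ^ (n + 1))⁻¹ * ((2 ^ 1) ^ n * volume R.cube.toSet) := by
      obtain ⟨x, hx⟩ := R.cube_nonempty
      rw [← Dyadic.volume_containing_add R x 1]
      by_cases hRQ : R.1 + 1 ≤ Q.1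
      · refine le_trans (measure_mono (inter_subset_inter_left _ ?_))
          (hnot _ (Dyadic.not_of_mem_maximal hR hx (by simp) hRQ)).1
        conv_lhs => rw [← Dyadic.mem_cube_iff.1 hx]
        exact Dyadic.containing_subset (by simp) x
      · have h1 : volume Q.cube.toSet ≤
            volume (Dyadic.containing (R.1 + (1 : ℕ)) x).cube.toSet := by
          rw [Cube.volume_toSet, Cube.volume_toSet]
          gcongr
          exact zpow_le_zpow_right₀ (by norm_num) (show Q.1 ≤ R.1 + (1 : ℕ) by push_cast; omega)
        have h2 : volume E ≤ (2 ^ (n + 1))⁻¹ * volume Q.cube.toSet := by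
          rw [mul_comm, ← div_eq_mul_inv, ENNReal.le_div_iff_mul_le (by simp) (by simp), mul_comm]
          refine le_trans ?_ hEQ
          gcongr
          refine le_mul_of_one_le_left zero_le ?_
          exact_mod_cast Nat.succ_le_of_lt (show 0 < 4 * 25 ^ n by positivity)
        exact (measure_mono inter_subset_right).trans (h2.trans (by gcongr))
    calc 2 * volume (R.cube.toSet ∩ E)
        ≤ 2 * ((2 ^ (n + 1))⁻¹ * ((2 ^ 1) ^ n * volume R.cube.toSet)) := by gcongr
      _ = 2 ^ (n + 1) * (2 ^ (n + 1))⁻¹ * volume R.cube.toSet := by ring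
      _ = volume R.cube.toSet := by
          rw [ENNReal.mul_inv_cancel (by simp) (by simp), one_mul]
  have hsub : ∀ R ∈ ch, R.cube.toSet ⊆ Q.cube.toSet := fun R hR =>
    Dyadic.subset_of_mem_maximal hR
  have hloc : ∀ R ∈ ch, localize T hF R.cube = localize T hf R.cube := by
    intro R hR
    have hRD : R.cube.five.toSet ⊆ D := Cube.five_subset_five (hsub R hR)
    funext x
    simp only [localize, F, indicator_indicator, inter_eq_self_of_subset_left hRD]
  -- The level is that of `Q`, not of `R`: the averages over `5R ⊆ 8R` are controlled through the
  -- second ancestor by those over `5Q`, at the cost of `4^n ≤ 25^n`.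
  have hB : ∀ R ∈ ch, 4 * volume {x | s * (opNorm T * P) < localize T hf R.cube x} ≤
      volume R.cube.toSet := by
    intro R hR
    have h := mul_volume_lt_localize_le hr hm hT hF R.cube ha
      (V := 4 * m * 125 ^ n * ((2 ^ 2) ^ n * volume R.cube.toSet)) (fun i => by
        have hsub8 : R.cube.five.toSet ⊆
            (R.cube.dilate (2 ^ (2 + 1)) (by positivity)).toSet := by
          intro y hy
          rw [Cube.mem_toSet] at hy ⊢
          intro l
          have := hy l
          have := R.cube.side_pos
          simp only [Cube.five, Cube.dilate] at *
          constructor <;> linarith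
        refine ((lintegral_mono_set hsub8).trans (hdil R hR i 2 (by norm_num))).trans_eq ?_
        rw [hb]
        ring) hσ0
    rw [hloc R hR, ← hs, ← hP, hσcoe, mul_assoc, ENNReal.mul_le_mul_iff_right hlam0 hlamtop] at h
    refine (ENNReal.mul_le_mul_iff_right (a := 25 ^ n) (by simp) (by simp)).1 ?_
    calc 25 ^ n * (4 * volume {x | s * (opNorm T * P) < localize T hf R.cube x})
        = 4 * 25 ^ n * 1 * volume {x | s * (opNorm T * P) < localize T hf R.cube x} := by ring
      _ ≤ 4 * 25 ^ n * 2 ^ (n + 1) *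
            volume {x | s * (opNorm T * P) < localize T hf R.cube x} := by
          gcongr
          exact one_le_pow₀ (by norm_num)
      _ ≤ (2 ^ 2) ^ n * volume R.cube.toSet := h
      _ ≤ 25 ^ n * volume R.cube.toSet := by
          gcongr
          norm_num
  have hosc : ∀ R ∈ ch, ∀ᵐ x : Fin n → ℝ, x ∈ R.cube.toSet →
      localize T hf Q.cube x ≤ A + localize T hf R.cube x := by
    intro R hR
    let G₁ := T fun i => (hF i).toLp (F i)
    let G₂ := T fun i => ((hF i).indicator R.cube.five.measurableSet_toSet).toLp
      (R.cube.five.toSet.indicator (F i))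
    have hG₁ : ∀ x, ‖G₁ x‖ₑ = localize T hf Q.cube x := fun x => rfl
    have hG₂ : ∀ x, ‖G₂ x‖ₑ = localize T hf R.cube x := fun x => congrFun (hloc R hR) x
    have h := ae_ae_enorm_sub_indicator_sub_le hr hm hK hT hF hFc R.cube
      (g := fun x => G₁ x - G₂ x) (fun x => rfl)
      (M := (4 * m * 125 ^ n) ^ ((m : ℝ) / r) * P) (fun k => by
        have hdd : (R.cube.dilate 2 (by norm_num)).twoPow (k + 1) =
            R.cube.dilate (2 ^ (k + 1 + 1)) (by positivity) := by
          ext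
          · rfl
          · simp only [Cube.twoPow, Cube.dilate]
            ring
        rw [hdd, ← mul_assoc, ← ENNReal.mul_rpow_of_nonneg _ _ hmr, hP, ← prod_mul_rpow hr]
        gcongr with i
        refine (hdil R hR i (k + 1) (by omega)).trans ?_
        rw [Cube.volume_dilate, ENNReal.ofReal_pow (by norm_num), ENNReal.ofReal_ofNat, hb]
        calc 4 * m * 125 ^ n * a i * ((2 ^ (k + 1)) ^ n * volume R.cube.toSet)
            ≤ 4 * m * 125 ^ n * a i * ((2 ^ (k + 1 + 1)) ^ n * volume R.cube.toSet) := by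
              gcongr
              · norm_num
              · omega
          _ = _ := by ring)
    filter_upwards [h] with x hx hxR
    have hz := hx hxR
    -- The two bad sets fill at most `1/2 + 1/4` of `R`, so a good comparison point is left.
    have hex : ∃ z ∈ R.cube.toSet, ‖(G₁ x - G₂ x) - (G₁ z - G₂ z)‖ₑ ≤ hormanderConst r K *
        ((4 * m * 125 ^ n) ^ ((m : ℝ) / r) * P) ∧
        localize T hf Q.cube z ≤ s * (opNorm T * P) ∧
        localize T hf R.cube z ≤ s * (opNorm T * P) := by
      by_contra! hcon
      set B : Set (Fin n → ℝ) := {x | s * (opNorm T * P) < localize T hf R.cube x}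
      have hle : volume R.cube.toSet ≤ volume ((R.cube.toSet ∩ E) ∪ B) := by
        refine measure_mono_ae ?_
        filter_upwards [hz] with z hz' hzR
        by_cases hzE : localize T hf Q.cube z ≤ s * (opNorm T * P)
        · exact Or.inr (hcon z hzR (hz' hzR) hzE)
        · exact Or.inl ⟨hzR, not_le.1 hzE⟩
      have h4 : 4 * volume R.cube.toSet ≤ 3 * volume R.cube.toSet :=
        calc 4 * volume R.cube.toSet
            ≤ 4 * (volume (R.cube.toSet ∩ E) + volume B) := by
              gcongr
              exact hle.trans (measure_union_le _ _)
          _ = 2 * (2 * volume (R.cube.toSet ∩ E)) + 4 * volume B := by ring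
          _ ≤ 2 * volume R.cube.toSet + volume R.cube.toSet := by
              gcongr
              · exact hRE R hR
              · exact hB R hR
          _ = 3 * volume R.cube.toSet := by ring
      rw [ENNReal.mul_le_mul_iff_left R.cube.volume_toSet_ne_zero R.cube.volume_toSet_ne_top] at h4
      norm_num at h4
    obtain ⟨z, -, h1, h2, h3⟩ := hex
    rw [← hG₁] at h2 ⊢
    rw [← hG₂] at h3 ⊢
    have hlam : (4 * m * 125 ^ n : ℝ≥0∞) ^ ((m : ℝ) / r) ≤ s := by
      rw [hs, ENNReal.coe_rpow_of_nonneg _ hmr, hσcoe]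
      refine ENNReal.rpow_le_rpow (le_mul_of_one_le_right zero_le ?_) hmr
      exact_mod_cast Nat.succ_le_of_lt (show 0 < 4 * 25 ^ n * 2 ^ (n + 1) by positivity)
    have htri : ‖G₁ x‖ₑ ≤ ‖(G₁ x - G₂ x) - (G₁ z - G₂ z)‖ₑ + (‖G₁ z‖ₑ + ‖G₂ z‖ₑ) + ‖G₂ x‖ₑ := by
      calc ‖G₁ x‖ₑ = ‖((G₁ x - G₂ x) - (G₁ z - G₂ z)) + (G₁ z - G₂ z) + G₂ x‖ₑ := by
            congr 1
            ring
        _ ≤ ‖(G₁ x - G₂ x) - (G₁ z - G₂ z)‖ₑ + ‖G₁ z - G₂ z‖ₑ + ‖G₂ x‖ₑ := enorm_add₃_le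
        _ ≤ _ := by
            gcongr
            exact enorm_sub_le
    refine htri.trans ?_
    gcongr
    calc ‖(G₁ x - G₂ x) - (G₁ z - G₂ z)‖ₑ + (‖G₁ z‖ₑ + ‖G₂ z‖ₑ)
        ≤ hormanderConst r K * (s * P) + (s * (opNorm T * P) + s * (opNorm T * P)) := by
          gcongr
          exact h1.trans (by gcongr)
      _ ≤ hormanderConst r K * (s * P) + hormanderConst r K * (s * P) +
            (s * (opNorm T * P) + s * (opNorm T * P)) := by
          gcongr
          exact le_self_add
      _ = A := by
          rw [hA, hPavg]
          push_cast
          ring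
  refine ⟨ch, hsub, Dyadic.pairwiseDisjoint_maximal _ _,
    Dyadic.two_mul_volume_union_maximal_le hm hE hEQ ha hgint,
    (ae_ball_iff ch.to_countable).2 hosc, ?_⟩
  have hθ : ((2 : ℝ≥0∞) ^ (n + 1))⁻¹ < 1 := by
    rw [ENNReal.inv_lt_one]
    exact one_lt_pow₀ (by norm_num) (by omega)
  filter_upwards [Dyadic.ae_exists_lt_volume_inter hE Q.1 hθ] with x hx hxQ
  -- A density point of `E` would lie in a cube that meets the stopping condition.
  have hxE : x ∉ E := fun h => by
    obtain ⟨i, hi⟩ := hx h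
    exact hxQ.2 (Dyadic.mem_union_maximal hxQ.1 (Or.inl hi))
  refine (not_lt.1 hxE).trans ?_
  rw [hA, hPavg]
  calc s * (opNorm T * P) ≤ s * (opNorm T * P) +
        (s * (opNorm T * P) + 2 * s * hormanderConst r K * P) := le_self_add
    _ = _ := by
      push_cast
      ring

end SparseDomination

end

/-! ### The sparse domination theorem -/

theorem theorem1p2 (n : ℕ) (hn : 1 ≤ n) :
    ∃ γ : ℝ, 0 < γ ∧ γ < 1 ∧ ∀ (m : ℕ) (r : ℝ), 1 ≤ m → 1 ≤ r →
      ∃ c : ℝ≥0, ∀ (𝕜 : Type*) [RCLike 𝕜]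
        (T : SparseDomination.MultilinearOperator 𝕜 n m r)
        (K : (Fin n → ℝ) → (Fin m → Fin n → ℝ) → 𝕜),
        SparseDomination.HasKernel T K →
        SparseDomination.opNorm T < ∞ →
        SparseDomination.hormanderConst r K < ∞ →
        ∀ (f : Fin m → (Fin n → ℝ) → 𝕜)
          (hf : ∀ i, MemLp (f i) (ENNReal.ofReal r) volume),
          (∀ i, HasCompactSupport (f i)) →
          ∃ S : Set (SparseDomination.Cube n), SparseDomination.IsSparse γ S ∧
            ∀ᵐ x : Fin n → ℝ,
              ‖T (fun i => (hf i).toLp (f i)) x‖ₑ ≤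
                c * (SparseDomination.opNorm T + SparseDomination.hormanderConst r K) *
                  SparseDomination.sparseSum r S f x := by
  open SparseDomination Set in
  -- In `γ`, the `1/2` is the part of a cube left free by its children and `5^{-n}` comes from
  -- passing to the dilate. The 2 in `c` counts the two values at the comparison point.
  refine ⟨(2 * 5 ^ n)⁻¹, by positivity, ?_, fun m r hm hr => ⟨2 * sparseConst n m ^ ((m : ℝ) / r),
    fun 𝕜 _ T K hK hT _ f hf hc => ?_⟩⟩
  · refine inv_lt_one_of_one_lt₀ ?_
    have : (1 : ℝ) ≤ 5 ^ n := one_le_pow₀ (by norm_num)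
    linarith
  obtain ⟨N, hN⟩ : ∃ N : ℕ, ∀ i y, f i y ≠ 0 → ∀ l, |y l| < 2 ^ N := by
    have hbdd : Bornology.IsBounded (⋃ i, tsupport (f i)) :=
      (isCompact_iUnion fun i => hc i).isBounded
    obtain ⟨C, hC⟩ := hbdd.exists_norm_le
    obtain ⟨N, hN⟩ := pow_unbounded_of_one_lt C (by norm_num : (1 : ℝ) < 2)
    refine ⟨N, fun i y hy l => lt_of_le_of_lt ?_ hN⟩
    exact (norm_le_pi_norm y l).trans (hC y (mem_iUnion.2 ⟨i, subset_tsupport _ hy⟩))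
  obtain ⟨F₀, hF₀, hcov, hF₀N⟩ := Dyadic.exists_partition n N
  choose ch hsub hdisj hvol hin hout using
    fun Q : Dyadic n => exists_children hr hm hK hT hf hc Q rfl
  obtain ⟨F, ⟨E, hE, hEdisj⟩, hF⟩ := Dyadic.exists_sparse_of_children hsub hdisj hF₀ hvol _
    (fun Q => localize T hf Q.cube) hin hout
  let ψ : Dyadic n → Cube n := fun P => P.cube.five
  have hψ : Function.Injective ψ := Cube.five_injective.comp Dyadic.cube_injective
  -- The disjoint sets of the dyadic cubes are kept and re-indexed by the dilates, which is possible
  -- because `ψ` is injective.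
  refine ⟨ψ '' F, ⟨Function.extend ψ E fun _ => ∅, ?_, ?_⟩, ?_⟩
  · rintro _ ⟨P, -, rfl⟩
    rw [hψ.extend_apply]
    obtain ⟨h1, h2, h3⟩ := hE P
    refine ⟨h1, h2.trans P.cube.toSet_subset_five, ?_⟩
    have h5 : ENNReal.ofReal (2 * 5 ^ n)⁻¹ = (2 * 5 ^ n)⁻¹ := by
      rw [ENNReal.ofReal_inv_of_pos (by positivity), ENNReal.ofReal_mul (by norm_num),
        ENNReal.ofReal_pow (by norm_num)]
      simp
    rw [h5, Cube.volume_five]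
    calc (2 * 5 ^ n)⁻¹ * (5 ^ n * volume P.cube.toSet)
        ≤ (2 * 5 ^ n)⁻¹ * (5 ^ n * (2 * volume (E P))) := by gcongr
      _ = (2 * 5 ^ n) * (2 * 5 ^ n)⁻¹ * volume (E P) := by ring
      _ = volume (E P) := by
          rw [ENNReal.mul_inv_cancel (by simp) (ENNReal.mul_ne_top (by simp) (by simp)), one_mul]
  · rintro _ ⟨P, hP, rfl⟩ _ ⟨P', hP', rfl⟩ hne
    simp only [Function.onFun, hψ.extend_apply]
    exact hEdisj hP hP' fun h => hne (congrArg ψ h)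
  · filter_upwards [hF] with x hx
    obtain ⟨Q, hQ, hxQ⟩ := hcov x
    have hQf : ∀ i, Q.cube.five.toSet.indicator (f i) = f i := fun i =>
      indicator_eq_self.2 fun y hy => hF₀N Q hQ y (hN i y hy)
    have hloc : localize T hf Q.cube x = ‖T (fun i => (hf i).toLp (f i)) x‖ₑ := by
      simp only [localize, hQf]
    rw [← hloc]
    refine (hx Q hQ hxQ).trans ?_
    rw [sparseSum, ← ENNReal.tsum_mul_left]
    refine le_trans ?_ (ENNReal.tsum_comp_le_tsum_of_injective
      (f := fun P : F => (⟨ψ P, mem_image_of_mem ψ P.2⟩ : ψ '' F))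
      (fun P P' h => Subtype.ext (hψ (congrArg Subtype.val h))) _)
    refine ENNReal.tsum_le_tsum fun P => ?_
    by_cases hxP : x ∈ (P : Dyadic n).cube.toSet
    · rw [indicator_of_mem hxP, indicator_of_mem (Cube.toSet_subset_five _ hxP)]
      rfl
    · rw [indicator_of_notMem hxP]
      exact zero_le
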